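/- Let $G=(V,E)$ be a finite simple connected graph with at least $3$ vertices, and let $w\colon E\to(0,\infty)$ be a function assigning a positive weight to every edge. The weighted graph $(G,w)$ is called stable, or weighted distance-hereditary, if the polynomial \[ P_{G,w}\bigl((x_v)_{v\in V}\bigr)=\sum_{T}\ \prod_{e\in E(T)}w(e)\ \prod_{v\in V}x_v^{\deg_T(v)-1}, \] where $T$ runs over all spanning trees of $G$, does not vanish whenever all the variables $x_v$ are complex numbers with positive imaginary part. Let $M$ be the weighted adjacency matrix of $(G,w)$: the real symmetric matrix indexed by $V$ with $M_{ab}=w(ab)$ if $ab\in E$ and $M_{ab}=0$ otherwise. For $A\subseteq V$ let $\operatorname{cutrk}(A)$ be the rank over $\mathbb{R}$ of the submatrix of $M$ with columns indexed by $A$ and rows indexed by $V\setminus A$; thus $\operatorname{cutrk}(A)=\operatorname{cutrk}(V\setminus A)$. Consider finite trees $T$ whose leaves are exactly the elements of $V$ and all of whose other vertices have degree $3$. Deleting an edge $e$ of such a tree $T$ splits $T$ into two components and hence $V$ into two parts $A(e)$ and $B(e)$; the width of $e$ is $\operatorname{cutrk}(A(e))=\operatorname{cutrk}(B(e))$. The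 weighted rank-width of $(G,w)$ is the minimum, over all such trees $T$, of the maximum width of an edge of $T$. Then $(G,w)$ is weighted distance-hereditary if and only if its weighted rank-width equals $1$. -/

import Mathlib

noncomputable section

open scoped Classical

universe u

namespace WeightedGraph

variable {V : Type u}

/-- The weighted vertex spanning polynomial
`∑_T ∏_{e ∈ E(T)} w(e) ∏_v x_v ^ (deg_T(v) - 1)`, the sum being over all spanning trees `T` of `G`.
For a graph with at least two vertices all degrees `deg_T(v)` are at least one, so that the
subtraction is the usual one. -/
def spanningPolynomial [Fintype V] (G : SimpleGraph V) (w : Sym2 V → ℝ) : MvPolynomial V ℝ :=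
  ∑ T : SimpleGraph V with T ≤ G ∧ T.IsTree,
    MvPolynomial.C (∏ e ∈ T.edgeFinset, w e) * ∏ v, MvPolynomial.X v ^ (T.degree v - 1)

/-- A real polynomial is real stable if it has no zeros with all coordinates in the open upper
half-plane. -/
def IsRealStable {σ : Type*} (P : MvPolynomial σ ℝ) : Prop :=
  ∀ z : σ → ℂ, (∀ i, 0 < (z i).im) → MvPolynomial.aeval z P ≠ 0

/-- A weighted graph is stable if its weighted vertex spanning polynomial is real stable. -/
def IsStable [Fintype V] (G : SimpleGraph V) (w : Sym2 V → ℝ) : Prop :=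
  IsRealStable (spanningPolynomial G w)

/-- Weighted distance-hereditary graphs are, by definition, the stable weighted graphs. -/
def IsDistanceHereditary [Fintype V] (G : SimpleGraph V) (w : Sym2 V → ℝ) : Prop :=
  IsStable G w

/-- The weighted adjacency matrix. -/
def adjMatrix (G : SimpleGraph V) (w : Sym2 V → ℝ) : Matrix V V ℝ :=
  Matrix.of fun a b => if G.Adj a b then w s(a, b) else 0

/-- The rank of the submatrix of the weighted adjacency matrix with columns `A` and rows `B`. -/
def rk [Fintype V] (G : SimpleGraph V) (w : Sym2 V → ℝ) (A B : Set V) : ℕ :=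
  ((adjMatrix G w).submatrix (Subtype.val : B → V) (Subtype.val : A → V)).rank

/-- The cut-rank of a set of vertices. -/
def cutRank [Fintype V] (G : SimpleGraph V) (w : Sym2 V → ℝ) (A : Set V) : ℕ :=
  rk G w A Aᶜ

/-- A finite tree whose leaves are exactly (labelled bijectively by) the elements of `V`,
and all of whose other vertices have degree three. -/
structure RankDecomposition (V : Type u) where
  /-- the vertices of the tree -/
  Node : Type u
  /-- there are finitely many of them -/
  [fintypeNode : Fintype Node]
  /-- the tree -/
  tree : SimpleGraph Node
  isTree : tree.IsTree
  /-- the leaf corresponding to an element of `V` -/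
  leaf : V → Node
  leaf_injective : Function.Injective leaf
  degree_eq_one_iff : ∀ t, tree.degree t = 1 ↔ t ∈ Set.range leaf
  degree_eq_three : ∀ t, t ∉ Set.range leaf → tree.degree t = 3

attribute [instance] RankDecomposition.fintypeNode

/-- For an edge `ab` of the tree, the elements of `V` whose leaves lie in the component of `a`
after deletion of this edge. -/
def RankDecomposition.side (D : RankDecomposition V) (a b : D.Node) : Set V :=
  {v | (D.tree.deleteEdges {s(a, b)}).Reachable a (D.leaf v)}

/-- The maximum over the edges of the tree of the cut-rank of the partition given by the edge
(each edge is considered in both directions, which give the two sides of the same partition). -/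
def RankDecomposition.width [Fintype V] (D : RankDecomposition V)
    (G : SimpleGraph V) (w : Sym2 V → ℝ) : ℕ :=
  Finset.univ.sup fun d : D.tree.Dart => cutRank G w (D.side d.fst d.snd)

/-- The weighted rank-width: the minimum of the widths of all trees as above. -/
def rankWidth [Fintype V] (G : SimpleGraph V) (w : Sym2 V → ℝ) : ℕ :=
  sInf (Set.range fun D : RankDecomposition V => D.width G w)

end WeightedGraph

end

noncomputable section

open scoped Classical

universe u

namespace WeightedGraph

/-! ### Matrix-tree theorem by counting functions directed towards a root -/

section MatrixTree

variable {V : Type*} {r : V}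

/-! By the matrix-tree theorem, `x_r * P(x)` is the determinant of a reduced Laplacian with entries
built from `M a b * x b`. Hence stability says that, for all `x` in the upper half-plane, the
equations `∑ b, M a b * x b * (z b - z a) = 0` have only constant solutions `z` (`RigidOn`,
`isStable_iff_rigidOn`). In this form vertices can be eliminated or merged one at a time.

Stability gives rank-width one as follows. Local complementation is a substitution in `x`, so it
preserves rigidity. Repeating it makes all off-diagonal weights positive, and vanishing of cut
minors passes back to the original matrix (`exists_positive_of_rigidOn`). On four vertices with
positive weights, if the three perfect matchings have distinct products, the middle one yields an
explicit nonconstant solution (`not_rigidOn_of_klein`). So two products always agree, and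
eliminating the other vertices extends this to every quadruple (`fourPoint_of_rigidOn`). Dividing `M
a b` by `M r a * M r b` turns this into the axioms of a symbolic ultrametric, whose twins are
vertices with proportional rows (`exists_cherry_of_fourPoint`). Removing one twin and reattaching it
as a leaf beside the other builds the tree (`exists_rankDecomposition`).

Conversely, in a tree of width one some edge cuts off exactly two elements of any given set of at
least three vertices. Their rows are then proportional outside the pair, and merging them reduces
rigidity to a smaller connected set (`RigidOn.of_twin`, `rigidOn_of_exists_cherry`). Connectedness
rules out rank zero at a leaf edge. -/

/-- The graph whose edges join every vertex `a ≠ r` to its image `φ a`. -/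
def functionGraph (φ : {a : V // a ≠ r} → V) : SimpleGraph V where
  Adj u v := u ≠ v ∧ ((∃ h, φ ⟨u, h⟩ = v) ∨ ∃ h, φ ⟨v, h⟩ = u)
  symm := ⟨fun _ _ h => ⟨h.1.symm, h.2.symm⟩⟩
  loopless := ⟨fun _ h => h.1 rfl⟩

theorem functionGraph_adj {φ : {a : V // a ≠ r} → V} (a : {a : V // a ≠ r}) (h : φ a ≠ a) :
    (functionGraph φ).Adj a (φ a) :=
  ⟨h.symm, Or.inl ⟨a.2, rfl⟩⟩

theorem exists_adj_dist_lt {T : SimpleGraph V} (hT : T.Connected) {a : V} (ha : a ≠ r) :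
    ∃ b, T.Adj a b ∧ T.dist b r < T.dist a r := by
  obtain ⟨p, hp⟩ := hT.exists_walk_length_eq_dist a r
  cases p with
  | nil => exact absurd rfl ha
  | cons h q =>
    refine ⟨_, h, ?_⟩
    rw [← hp, SimpleGraph.Walk.length_cons]
    exact Nat.lt_succ_of_le (SimpleGraph.dist_le q)

/-- Some neighbour `b` of `a` is nearer to `r`. If the edge came from `φ b = a`, induction at `b`
would make `a` nearer than `b`. So the pointers run down to the root, which is what excludes cycles
below. -/
theorem functionGraph_dist_lt {φ : {a : V // a ≠ r} → V} (h : (functionGraph φ).Connected) :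
    ∀ a : {a : V // a ≠ r}, (functionGraph φ).dist (φ a) r < (functionGraph φ).dist a r := by
  suffices H : ∀ n, ∀ a : {a : V // a ≠ r}, (functionGraph φ).dist a r = n →
      (functionGraph φ).dist (φ a) r < (functionGraph φ).dist a r from fun a => H _ a rfl
  intro n
  induction n using Nat.strong_induction_on with
  | _ n ih =>
    rintro a rfl
    obtain ⟨b, hab, hb⟩ := exists_adj_dist_lt h a.2
    obtain ⟨-, ⟨_, h1⟩ | ⟨h2, h1⟩⟩ := hab
    · rw [h1]; exact hb
    · have := ih _ hb ⟨b, h2⟩ rfl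
      rw [h1] at this
      exact absurd (this.trans hb) (lt_irrefl _)

theorem functionGraph_ne {φ : {a : V // a ≠ r} → V} (h : (functionGraph φ).Connected)
    (a : {a : V // a ≠ r}) : φ a ≠ a := fun e => by
  have := functionGraph_dist_lt h a
  rw [e] at this
  exact lt_irrefl _ this

theorem functionGraph_edge_injective {φ : {a : V // a ≠ r} → V} (h : (functionGraph φ).Connected) :
    Function.Injective fun a : {a : V // a ≠ r} => s((a : V), φ a) := by
  intro a b hab
  have ha := functionGraph_dist_lt h a
  have hb := functionGraph_dist_lt h b
  rcases Sym2.eq_iff.1 hab with ⟨h1, -⟩ | ⟨h1, h2⟩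
  · exact Subtype.ext h1
  · rw [h2] at ha
    rw [← h1] at hb
    exact absurd (ha.trans hb) (lt_irrefl _)

theorem functionGraph_edgeSet {φ : {a : V // a ≠ r} → V} (h : (functionGraph φ).Connected) :
    (functionGraph φ).edgeSet = Set.range fun a : {a : V // a ≠ r} => s((a : V), φ a) := by
  ext e
  induction e with
  | _ u v =>
    rw [SimpleGraph.mem_edgeSet]
    constructor
    · rintro ⟨-, ⟨h1, h2⟩ | ⟨h1, h2⟩⟩
      · exact ⟨⟨u, h1⟩, by simp [h2]⟩
      · exact ⟨⟨v, h1⟩, by simp [h2]⟩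
    · rintro ⟨a, ha⟩
      rw [← SimpleGraph.mem_edgeSet, ← ha]
      exact functionGraph_adj a (functionGraph_ne h a)

theorem functionGraph_injective {φ ψ : {a : V // a ≠ r} → V} (h : (functionGraph φ).Connected)
    (e : functionGraph φ = functionGraph ψ) : φ = ψ := by
  have hφ := functionGraph_dist_lt h
  have hψ := functionGraph_dist_lt (e ▸ h)
  rw [← e] at hψ
  funext a
  have h1 := functionGraph_adj a (functionGraph_ne h a)
  rw [e] at h1
  obtain ⟨-, ⟨_, h2⟩ | ⟨h3, h2⟩⟩ := h1
  · exact h2.symm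
  · have := hψ ⟨_, h3⟩
    rw [h2] at this
    exact absurd (this.trans (hφ a)) (lt_irrefl _)

/-- Point each vertex to a neighbour nearer to `r`. The result is a connected subgraph of a tree,
hence the whole tree by minimality. -/
theorem exists_functionGraph_eq (r : V) {T : SimpleGraph V} (hT : T.IsTree) :
    ∃ φ : {a : V // a ≠ r} → V, functionGraph φ = T := by
  choose φ hφ using fun a : {a : V // a ≠ r} => exists_adj_dist_lt hT.connected a.2
  have hle : functionGraph φ ≤ T := by
    rintro u v ⟨-, ⟨h, rfl⟩ | ⟨h, rfl⟩⟩
    · exact (hφ ⟨u, h⟩).1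
    · exact (hφ ⟨v, h⟩).1.symm
  have hreach : ∀ n, ∀ a, T.dist a r = n → (functionGraph φ).Reachable a r := by
    intro n
    induction n using Nat.strong_induction_on with
    | _ n ih =>
      rintro a rfl
      by_cases ha : a = r
      · rw [ha]
      · have := hφ ⟨a, ha⟩
        exact (functionGraph_adj ⟨a, ha⟩ this.1.ne').reachable.trans (ih _ this.2 _ rfl)
  have hconn : (functionGraph φ).Connected :=
    (SimpleGraph.connected_iff _).2 ⟨fun a b => (hreach _ a rfl).trans (hreach _ b rfl).symm, ⟨r⟩⟩
  exact ⟨φ, le_antisymm hle ((SimpleGraph.isTree_iff_minimal_connected.1 hT).2 hconn hle)⟩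

variable [Fintype V]

theorem functionGraph_isTree {φ : {a : V // a ≠ r} → V} (h : (functionGraph φ).Connected) :
    (functionGraph φ).IsTree := by
  rw [SimpleGraph.isTree_iff_connected_and_card]
  refine ⟨h, ?_⟩
  rw [functionGraph_edgeSet h, Nat.card_range_of_injective (functionGraph_edge_injective h)]
  rw [Nat.card_eq_fintype_card, Nat.card_eq_fintype_card, Fintype.card_subtype_compl]
  have : 0 < Fintype.card V := Fintype.card_pos_iff.2 ⟨r⟩
  simp
  omega

theorem functionGraph_prod_edges {φ : {a : V // a ≠ r} → V} (h : (functionGraph φ).Connected)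
    {K : Type*} [CommMonoid K] (f : Sym2 V → K) :
    ∏ e ∈ (functionGraph φ).edgeFinset, f e = ∏ a : {a : V // a ≠ r}, f s((a : V), φ a) := by
  rw [← Finset.prod_image (g := fun a : {a : V // a ≠ r} => s((a : V), φ a))
    ((functionGraph_edge_injective h).injOn)]
  congr 1
  ext e
  rw [SimpleGraph.mem_edgeFinset, functionGraph_edgeSet h]
  simp

/-- The neighbours of `v` are its preimages and, unless `v = r`, also `φ v`. The exception at the
root accounts for the extra factor `z r` in the determinant formula. -/
theorem functionGraph_degree {φ : {a : V // a ≠ r} → V} (h : (functionGraph φ).Connected) (v : V) :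
    (functionGraph φ).degree v
      = (Finset.univ.filter fun a => φ a = v).card + if v = r then 0 else 1 := by
  have hinj : Set.InjOn (Subtype.val : {a : V // a ≠ r} → V)
      (Finset.univ.filter fun a => φ a = v : Finset _) := Subtype.val_injective.injOn
  rw [← Finset.card_image_of_injOn hinj, ← SimpleGraph.card_neighborFinset_eq_degree]
  split_ifs with hv
  · rw [add_zero]
    congr 1
    ext u
    rw [SimpleGraph.mem_neighborFinset]
    simp only [Finset.mem_image, Finset.mem_filter, Finset.mem_univ, true_and]
    constructor
    · rintro ⟨h0, ⟨h1, -⟩ | ⟨h1, h2⟩⟩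
      · exact absurd hv h1
      · exact ⟨_, h2, rfl⟩
    · rintro ⟨a, rfl, rfl⟩
      exact (functionGraph_adj a (functionGraph_ne h a)).symm
  · have hnot : φ ⟨v, hv⟩ ∉ (Finset.univ.filter fun a => φ a = v).image
        (Subtype.val : {a : V // a ≠ r} → V) := by
      simp only [Finset.mem_image, Finset.mem_filter, Finset.mem_univ, true_and]
      rintro ⟨a, h1, h2⟩
      have ha := functionGraph_dist_lt h a
      have hb := functionGraph_dist_lt h ⟨v, hv⟩
      rw [← h2] at hb
      rw [h1] at ha
      exact lt_irrefl _ (ha.trans hb)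
    rw [← Finset.card_insert_of_notMem hnot]
    congr 1
    ext u
    rw [SimpleGraph.mem_neighborFinset]
    simp only [Finset.mem_insert, Finset.mem_image, Finset.mem_filter, Finset.mem_univ, true_and]
    constructor
    · rintro ⟨h0, ⟨h1, h2⟩ | ⟨h1, h2⟩⟩
      · exact Or.inl h2.symm
      · exact Or.inr ⟨_, h2, rfl⟩
    · rintro (rfl | ⟨a, rfl, rfl⟩)
      · exact functionGraph_adj ⟨v, hv⟩ (functionGraph_ne h _)
      · exact (functionGraph_adj a (functionGraph_ne h a)).symm

/-- The rows of the matrix `1 - Φ`, where `Φ` is the matrix of the function `φ` on `V \ {r}`. -/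
def functionMatrix (K : Type*) [CommRing K] (φ : {a : V // a ≠ r} → V) :
    Matrix {a : V // a ≠ r} {a : V // a ≠ r} K :=
  Matrix.of fun a b => (if a = b then 1 else 0) - if φ a = b then 1 else 0

/-- A permutation with nonzero contribution follows `φ` wherever it moves a point. If it is not the
identity it lowers the total distance to `r`, which permutations preserve. -/
theorem det_functionMatrix_of_connected (K : Type*) [CommRing K] {φ : {a : V // a ≠ r} → V}
    (h : (functionGraph φ).Connected) : (functionMatrix K φ).det = 1 := by
  have hd := functionGraph_dist_lt h
  rw [← Matrix.det_transpose, Matrix.det_apply, Finset.sum_eq_single 1]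
  · rw [Equiv.Perm.sign_one, one_smul]
    refine Finset.prod_eq_one fun a _ => ?_
    simp [functionMatrix, functionGraph_ne h a]
  · intro σ _ hσ
    rw [smul_eq_zero_iff_eq]
    by_contra hne
    have hne' : ∀ a, functionMatrix K φ a (σ a) ≠ 0 := fun a ha =>
      hne (Finset.prod_eq_zero (Finset.mem_univ a) ha)
    have key : ∀ a, σ a ≠ a → φ a = σ a := by
      intro a ha
      by_contra hφ
      exact hne' a (by simp [functionMatrix, ha.symm, hφ])
    obtain ⟨a, ha⟩ : ∃ a, σ a ≠ a := by
      by_contra! hall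
      exact hσ (Equiv.ext hall)
    have : ∑ a, (functionGraph φ).dist (σ a) r < ∑ a : {a : V // a ≠ r}, (functionGraph φ).dist a r := by
      refine Finset.sum_lt_sum (fun b _ => ?_) ⟨a, Finset.mem_univ _, ?_⟩
      · by_cases hb : σ b = b
        · rw [hb]
        · rw [← key b hb]
          exact (hd b).le
      · rw [← key a ha]
        exact hd a
    rw [Equiv.sum_comp σ fun a => (functionGraph φ).dist (a : V) r] at this
    exact lt_irrefl _ this
  · simp

/-- The indicator of a component missing `r` lies in the kernel. -/
theorem det_functionMatrix_of_not_connected (K : Type*) [Field K] {φ : {a : V // a ≠ r} → V}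
    (h : ¬(functionGraph φ).Connected) : (functionMatrix K φ).det = 0 := by
  have : ∃ c, ¬(functionGraph φ).Reachable c r := by
    by_contra! hall
    exact h ((SimpleGraph.connected_iff _).2
      ⟨fun a b => (hall a).trans (hall b).symm, ⟨r⟩⟩)
  obtain ⟨c, hc⟩ := this
  have hcr : c ≠ r := fun e => hc (by rw [SimpleGraph.reachable_iff_reflTransGen, e])
  rw [← Matrix.exists_mulVec_eq_zero_iff]
  refine ⟨fun a => if (functionGraph φ).Reachable a c then 1 else 0, ?_, ?_⟩
  · intro h0
    have := congrFun h0 ⟨c, hcr⟩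
    simp at this
  · funext a
    have hstep : (functionGraph φ).Reachable a c ↔ (functionGraph φ).Reachable (φ a) c := by
      by_cases hφ : φ a = a
      · rw [hφ]
      · have := (functionGraph_adj a hφ).reachable
        exact ⟨this.symm.trans, this.trans⟩
    simp only [Matrix.mulVec, dotProduct, functionMatrix, Matrix.of_apply, sub_mul,
      Finset.sum_sub_distrib, Pi.zero_apply, ite_mul, one_mul, zero_mul, Finset.sum_ite_eq,
      Finset.mem_univ, if_true, sub_eq_zero]
    by_cases hr : φ a = r
    · rw [if_neg fun h1 => hc ?_, Finset.sum_eq_zero]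
      · intro x _
        exact if_neg fun e => x.2 (e.symm.trans hr)
      · have := hstep.1 h1
        rw [hr] at this
        exact this.symm
    · rw [Finset.sum_eq_single ⟨φ a, hr⟩]
      · simp [hstep]
      · intro b _ hb
        rw [if_neg fun e => hb (Subtype.ext e.symm)]
      · simp

/-- The Laplacian of the weights `y` with the row and the column of `r` deleted. -/
def reducedLaplacian {K : Type*} [CommRing K] (r : V) (y : V → V → K) :
    Matrix {a : V // a ≠ r} {a : V // a ≠ r} K :=
  Matrix.of fun a b => (if a = b then ∑ c, y a c else 0) - y a b

/-- Row `a` is `∑ c, y a c • (e_a - e_c)` with `e_r = 0`. Multilinear expansion chooses one `c = φ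
a` per row. -/
theorem det_reducedLaplacian {K : Type*} [Field K] (r : V) (y : V → V → K) :
    (reducedLaplacian r y).det
      = ∑ φ : {a : V // a ≠ r} → V with (functionGraph φ).Connected,
        ∏ a : {a : V // a ≠ r}, y a (φ a) := by
  have hrow : reducedLaplacian r y = fun a : {a : V // a ≠ r} =>
      ∑ c, y a c • (fun b : {a : V // a ≠ r} =>
        ((if a = b then 1 else 0) - if c = b then 1 else 0 : K)) := by
    funext a b
    simp [reducedLaplacian, Finset.sum_apply, mul_sub, Finset.sum_sub_distrib]
  change Matrix.detRowAlternating.toMultilinearMap (reducedLaplacian r y) = _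
  rw [hrow, MultilinearMap.map_sum, Finset.sum_filter]
  refine Finset.sum_congr rfl fun φ _ => ?_
  rw [MultilinearMap.map_smul_univ]
  change _ • (functionMatrix K φ).det = _
  split_ifs with h
  · rw [det_functionMatrix_of_connected K h, smul_eq_mul, mul_one]
  · rw [det_functionMatrix_of_not_connected K h, smul_zero]

theorem aeval_spanningPolynomial {V : Type*} [Fintype V] (G : SimpleGraph V) (w : Sym2 V → ℝ)
    (z : V → ℂ) :
    MvPolynomial.aeval z (spanningPolynomial G w)
      = ∑ T : SimpleGraph V with T ≤ G ∧ T.IsTree,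
        (∏ e ∈ T.edgeFinset, (w e : ℂ)) * ∏ v, z v ^ (T.degree v - 1) := by
  simp [spanningPolynomial, map_sum, map_prod]

theorem det_reducedLaplacian_adjMatrix {V : Type*} [Fintype V] [Nontrivial V] (G : SimpleGraph V)
    (w : Sym2 V → ℝ) (z : V → ℂ) (r : V) :
    (reducedLaplacian r fun a b => (adjMatrix G w a b : ℂ) * z b).det
      = z r * MvPolynomial.aeval z (spanningPolynomial G w) := by
  rw [det_reducedLaplacian, aeval_spanningPolynomial, Finset.mul_sum]
  symm
  -- Functions using a non-edge of `G` have weight zero and may be discarded.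
  rw [← Finset.sum_filter_of_ne
    (p := fun φ : {a : V // a ≠ r} → V => functionGraph φ ≤ G)]
  swap
  · intro φ hφ hne u v huv
    rw [Finset.mem_filter] at hφ
    have hadj : ∀ a : {a : V // a ≠ r}, G.Adj a (φ a) := by
      intro a
      by_contra hG
      exact hne (Finset.prod_eq_zero (Finset.mem_univ a) (by simp [adjMatrix, hG]))
    obtain ⟨-, ⟨h1, rfl⟩ | ⟨h1, rfl⟩⟩ := huv
    · exact hadj ⟨u, h1⟩
    · exact (hadj ⟨v, h1⟩).symm
  symm
  refine Finset.sum_bij (fun φ _ => functionGraph φ) ?_ ?_ ?_ ?_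
  · intro φ hφ
    simp only [Finset.mem_filter, Finset.mem_univ, true_and] at hφ ⊢
    exact ⟨hφ.2, functionGraph_isTree hφ.1⟩
  · intro φ hφ ψ _ e
    simp only [Finset.mem_filter, Finset.mem_univ, true_and] at hφ
    exact functionGraph_injective hφ.1 e
  · intro T hT
    simp only [Finset.mem_filter, Finset.mem_univ, true_and] at hT
    obtain ⟨φ, rfl⟩ := exists_functionGraph_eq r hT.2
    exact ⟨φ, by simpa using ⟨hT.2.connected, hT.1⟩, rfl⟩
  · intro φ hφ
    simp only [Finset.mem_filter, Finset.mem_univ, true_and] at hφ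
    obtain ⟨hc, hG⟩ := hφ
    rw [functionGraph_prod_edges hc, Finset.prod_mul_distrib]
    have hadj : ∀ a : {a : V // a ≠ r}, G.Adj a (φ a) := fun a =>
      hG (functionGraph_adj a (functionGraph_ne hc a))
    have h1 : ∀ a : {a : V // a ≠ r}, (adjMatrix G w a (φ a) : ℂ) = w s((a : V), φ a) := fun a => by
      simp [adjMatrix, hadj a]
    simp only [h1]
    rw [mul_left_comm]
    congr 1
    have h2 : ∏ a, z (φ a) = ∏ v, z v ^ (Finset.univ.filter fun a => φ a = v).card := by
      rw [← Finset.prod_fiberwise (s := Finset.univ) (g := φ)]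
      refine Finset.prod_congr rfl fun v _ => ?_
      rw [Finset.prod_congr rfl (g := fun _ => z v)
        (fun a ha => by rw [(Finset.mem_filter.1 ha).2]), Finset.prod_const]
    rw [h2, ← Finset.mul_prod_erase _ _ (Finset.mem_univ r),
      ← Finset.mul_prod_erase _ (fun v => z v ^ (_ - 1)) (Finset.mem_univ r), ← mul_assoc,
      ← pow_succ']
    have hpos : 0 < (functionGraph φ).degree r := hc.preconnected.degree_pos_of_nontrivial r
    have hr := functionGraph_degree hc r
    rw [if_pos rfl, add_zero] at hr
    rw [Nat.sub_add_cancel hpos, hr]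
    congr 1
    refine Finset.prod_congr rfl fun v hv => ?_
    rw [functionGraph_degree hc v, if_neg (Finset.ne_of_mem_erase hv), Nat.add_sub_cancel]

end MatrixTree

/-! ### Stability as uniqueness of harmonic functions -/

section Rigidity

variable {V : Type*}

/-- For all vertex weights `x` in the upper half-plane, the only functions on `W` which are harmonic
with respect to the conductances `M a b * x a * x b` are the constants. -/
def RigidOn (M : V → V → ℝ) (W : Finset V) : Prop :=
  ∀ x : V → ℂ, (∀ v, 0 < (x v).im) → ∀ z : V → ℂ,
    (∀ a ∈ W, ∑ b ∈ W, (M a b : ℂ) * x b * (z b - z a) = 0) → ∀ a ∈ W, ∀ b ∈ W, z a = z b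

theorem reducedLaplacian_mulVec [Fintype V] {K : Type*} [CommRing K] {r : V} (y : V → V → K)
    (u : V → K) (hu : u r = 0) (a : {a : V // a ≠ r}) :
    (reducedLaplacian r y).mulVec (fun b => u b) a = -∑ c, y a c * (u c - u a) := by
  have h : ∑ b : {b : V // b ≠ r}, y a b * u b = ∑ b, y a b * u b := by
    rw [← Finset.sum_subtype (Finset.univ.erase r) (by simp) (fun b => y a b * u b),
      Finset.sum_erase _ (by simp [hu])]
  simp [Matrix.mulVec, dotProduct, reducedLaplacian, sub_mul, ite_mul, h, mul_sub,
    Finset.sum_mul]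

/-- Since `x r ≠ 0`, the polynomial vanishes exactly when the reduced Laplacian is singular. Kernel
vectors are functions vanishing at `r` and harmonic away from `r`. -/
theorem isStable_iff_rigidOn [Fintype V] [Nontrivial V] (G : SimpleGraph V) (w : Sym2 V → ℝ) :
    IsStable G w ↔ RigidOn (adjMatrix G w) Finset.univ := by
  obtain ⟨r⟩ : Nonempty V := inferInstance
  have hsymm : ∀ a b, adjMatrix G w a b = adjMatrix G w b a := fun a b => by
    simp [adjMatrix, SimpleGraph.adj_comm, Sym2.eq_swap]
  constructor
  · intro h x hx z hz
    have hne : x r ≠ 0 := fun e => by simpa [e] using hx r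
    have hdet := det_reducedLaplacian_adjMatrix G w x r
    have hker : (reducedLaplacian r fun a b => (adjMatrix G w a b : ℂ) * x b).mulVec
        (fun b => z b - z r) = 0 := by
      funext a
      rw [reducedLaplacian_mulVec _ (fun b => z b - z r) (sub_self _)]
      simpa using hz a (Finset.mem_univ _)
    have h0 : (fun b : {b : V // b ≠ r} => z b - z r) = 0 := by
      by_contra hcon
      have := Matrix.exists_mulVec_eq_zero_iff.1 ⟨_, hcon, hker⟩
      rw [hdet] at this
      exact mul_ne_zero hne (h x hx) this
    have hall : ∀ a, z a = z r := fun a => by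
      by_cases ha : a = r
      · rw [ha]
      · exact sub_eq_zero.1 (congrFun h0 ⟨a, ha⟩)
    exact fun a _ b _ => (hall a).trans (hall b).symm
  · intro h x hx hP
    have hdet := det_reducedLaplacian_adjMatrix G w x r
    rw [hP, mul_zero] at hdet
    obtain ⟨u, hu, hker⟩ := Matrix.exists_mulVec_eq_zero_iff.2 hdet
    set z : V → ℂ := fun a => if ha : a ≠ r then u ⟨a, ha⟩ else 0 with hz
    have hzr : z r = 0 := by simp [hz]
    have hzu : (fun b : {b : V // b ≠ r} => z b) = u := by
      funext b
      simp [hz, b.2]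
    have hharm : ∀ a, a ≠ r → ∑ b, (adjMatrix G w a b : ℂ) * x b * (z b - z a) = 0 := by
      intro a ha
      have := reducedLaplacian_mulVec (fun a b => (adjMatrix G w a b : ℂ) * x b) z hzr ⟨a, ha⟩
      rw [hzu, hker, Pi.zero_apply] at this
      exact neg_eq_zero.1 this.symm
    -- The terms `x a * M a b * x b * (z b - z a)` are antisymmetric, so the total is zero and
    -- harmonicity at `r` follows from that at all other vertices.
    have htot : ∑ a, x a * ∑ b, (adjMatrix G w a b : ℂ) * x b * (z b - z a) = 0 := by
      have : ∑ a, x a * ∑ b, (adjMatrix G w a b : ℂ) * x b * (z b - z a)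
          = -∑ a, x a * ∑ b, (adjMatrix G w a b : ℂ) * x b * (z b - z a) := by
        conv_lhs => simp only [Finset.mul_sum]
        rw [Finset.sum_comm, ← Finset.sum_neg_distrib]
        refine Finset.sum_congr rfl fun a _ => ?_
        rw [Finset.mul_sum, ← Finset.sum_neg_distrib]
        refine Finset.sum_congr rfl fun b _ => ?_
        rw [hsymm b a]
        ring
      exact self_eq_neg.1 this
    rw [Finset.sum_eq_single r (fun a _ ha => by rw [hharm a ha, mul_zero]) (by simp)] at htot
    have hne : x r ≠ 0 := fun e => by simpa [e] using hx r
    have hr := (mul_eq_zero.1 htot).resolve_left hne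
    have hconst := h x hx z fun a _ => by
      by_cases ha : a = r
      · rw [ha]; exact hr
      · exact hharm a ha
    refine hu ?_
    rw [← hzu]
    funext b
    exact (hconst b (Finset.mem_univ _) r (Finset.mem_univ _)).trans hzr

end Rigidity

/-! ### Operations preserving rigidity, and the four-vertex obstruction -/

section Operations

variable {V : Type*}

/-- A nonnegative symmetric matrix with zero diagonal. -/
structure IsWeight (M : V → V → ℝ) : Prop where
  symm : ∀ a b, M a b = M b a
  diag : ∀ a, M a a = 0
  nonneg : ∀ a b, 0 ≤ M a b

/-- The weighted local complementation at `v`. -/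
def localComplement (M : V → V → ℝ) (v : V) (τ : ℝ) (a b : V) : ℝ :=
  if a = b then 0 else M a b + τ * M v a * M v b

theorem IsWeight.localComplement {M : V → V → ℝ} (hM : IsWeight M) (v : V) {τ : ℝ} (hτ : 0 ≤ τ) :
    IsWeight (localComplement M v τ) where
  symm a b := by
    unfold WeightedGraph.localComplement
    simp only [eq_comm (a := a) (b := b), hM.symm a b]
    split_ifs
    · rfl
    · ring
  diag a := by simp [WeightedGraph.localComplement]
  nonneg a b := by
    have h1 := hM.nonneg a b
    have h2 := hM.nonneg v a
    have h3 := hM.nonneg v b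
    unfold WeightedGraph.localComplement
    split_ifs <;> positivity

theorem IsWeight.localComplement_self {M : V → V → ℝ} (hM : IsWeight M) (v : V) (τ : ℝ) (b : V) :
    WeightedGraph.localComplement M v τ v b = M v b := by
  unfold WeightedGraph.localComplement
  split_ifs with h
  · rw [← h, hM.diag]
  · rw [hM.diag]; ring

theorem localComplement_of_ne (M : V → V → ℝ) (v : V) (τ : ℝ) {a b : V} (h : a ≠ b) :
    localComplement M v τ a b = M a b + τ * M v a * M v b :=
  if_neg h

theorem IsWeight.le_localComplement {M : V → V → ℝ} (hM : IsWeight M) (v : V) {τ : ℝ} (hτ : 0 ≤ τ)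
    (a b : V) : M a b ≤ WeightedGraph.localComplement M v τ a b := by
  have h2 := hM.nonneg v a
  have h3 := hM.nonneg v b
  unfold WeightedGraph.localComplement
  split_ifs with h
  · rw [h, hM.diag]
  · have : 0 ≤ τ * M v a * M v b := by positivity
    linarith

theorem sum_localComplement (M : V → V → ℝ) (v : V) (τ : ℝ) (W : Finset V) (x z : V → ℂ) (a : V) :
    ∑ b ∈ W, (localComplement M v τ a b : ℂ) * x b * (z b - z a)
      = ∑ b ∈ W, (M a b : ℂ) * x b * (z b - z a)
        + τ * M v a * ∑ b ∈ W, (M v b : ℂ) * x b * (z b - z a) := by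
  rw [Finset.mul_sum, ← Finset.sum_add_distrib]
  refine Finset.sum_congr rfl fun b _ => ?_
  by_cases h : a = b
  · simp [h]
  · rw [localComplement_of_ne M v τ h]
    push_cast
    ring

theorem sum_mul_sub_eq (m : V → ℝ) (W : Finset V) (x z : V → ℂ) (c : ℂ) :
    ∑ b ∈ W, (m b : ℂ) * x b * (z b - c)
      = ∑ b ∈ W, (m b : ℂ) * x b * z b - (∑ b ∈ W, (m b : ℂ) * x b) * c := by
  simp only [mul_sub, Finset.sum_sub_distrib, Finset.sum_mul]

theorem im_sum_nonneg {m : V → ℝ} (hm : ∀ b, 0 ≤ m b) (W : Finset V) {x : V → ℂ}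
    (hx : ∀ b, 0 < (x b).im) : 0 ≤ (∑ b ∈ W, (m b : ℂ) * x b).im := by
  rw [Complex.im_sum]
  refine Finset.sum_nonneg fun b _ => ?_
  rw [Complex.im_ofReal_mul]
  exact mul_nonneg (hm b) (hx b).le

theorem im_sum_pos {m : V → ℝ} (hm : ∀ b, 0 ≤ m b) {W : Finset V} {x : V → ℂ}
    (hx : ∀ b, 0 < (x b).im) (h : ∃ b ∈ W, m b ≠ 0) : 0 < (∑ b ∈ W, (m b : ℂ) * x b).im := by
  rw [Complex.im_sum]
  obtain ⟨b, hb, hmb⟩ := h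
  refine Finset.sum_pos' (fun b _ => ?_) ⟨b, hb, ?_⟩
  · rw [Complex.im_ofReal_mul]
    exact mul_nonneg (hm b) (hx b).le
  · rw [Complex.im_ofReal_mul]
    exact mul_pos ((hm b).lt_of_ne' hmb) (hx b)

/-- A solution for the complemented weights at `x` solves the original system with `x v` replaced by
`x v + τ * S`, where `S = ∑ b, M v b * x b`. This stays in the upper half-plane because `S` has
nonnegative imaginary part. -/
theorem RigidOn.localComplement {M : V → V → ℝ} (hM : IsWeight M) {W : Finset V}
    (h : RigidOn M W) {v : V} (hv : v ∈ W) {τ : ℝ} (hτ : 0 ≤ τ) :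
    RigidOn (localComplement M v τ) W := by
  intro x hx z hz
  set S : ℂ := ∑ b ∈ W, (M v b : ℂ) * x b with hS
  refine h (fun b => x b + if b = v then τ * S else 0) (fun b => ?_) z fun a ha => ?_
  · rw [Complex.add_im]
    have := hx b
    split_ifs
    · rw [Complex.im_ofReal_mul]
      have := mul_nonneg hτ (im_sum_nonneg (hM.nonneg v) W hx)
      linarith
    · simpa using this
  · have hzv := hz v hv
    rw [sum_localComplement, hM.diag, Complex.ofReal_zero] at hzv
    have hza := hz a ha
    rw [sum_localComplement, sum_mul_sub_eq (M v)] at hza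
    rw [sum_mul_sub_eq (M v)] at hzv
    have : ∑ b ∈ W, (M a b : ℂ) * (x b + if b = v then τ * S else 0) * (z b - z a)
        = ∑ b ∈ W, (M a b : ℂ) * x b * (z b - z a) + M a v * (τ * S) * (z v - z a) := by
      simp only [mul_add, add_mul, Finset.sum_add_distrib, mul_ite, ite_mul, mul_zero, zero_mul]
      rw [Finset.sum_ite_eq' W v, if_pos hv]
    rw [this, hM.symm a v]
    rw [← hS] at hza hzv
    linear_combination hza - τ * M v a * hzv

/-- Star-mesh elimination: with `x v = τ * S` and `z v = Z / S`, the equation at `v` holds and the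
effect of `v` on the others is exactly the term added by local complementation. -/
theorem RigidOn.eliminate {M : V → V → ℝ} (hM : IsWeight M) {W : Finset V}
    (h : RigidOn M W) {v : V} (hv : v ∈ W) {τ : ℝ} (hτ : 0 < τ) (hne : ∃ b ∈ W.erase v, M v b ≠ 0) :
    RigidOn (WeightedGraph.localComplement M v τ) (W.erase v) := by
  intro x hx z hz
  set S : ℂ := ∑ b ∈ W.erase v, (M v b : ℂ) * x b with hS
  have hSim : 0 < S.im := im_sum_pos (hM.nonneg v) hx hne
  have hS0 : S ≠ 0 := fun e => by simp [e] at hSim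
  set Z : ℂ := ∑ b ∈ W.erase v, (M v b : ℂ) * x b * z b with hZ
  have key := h (Function.update x v (τ * S)) (fun b => ?_) (Function.update z v (Z / S))
    fun a ha => ?_
  · intro a ha b hb
    have := key a (Finset.mem_of_mem_erase ha) b (Finset.mem_of_mem_erase hb)
    rwa [Function.update_of_ne (Finset.ne_of_mem_erase ha),
      Function.update_of_ne (Finset.ne_of_mem_erase hb)] at this
  · by_cases hb : b = v
    · rw [hb, Function.update_self, Complex.im_ofReal_mul]
      exact mul_pos hτ hSim
    · rw [Function.update_of_ne hb]
      exact hx b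
  · rw [← Finset.add_sum_erase _ _ hv]
    have hsum : ∀ c, ∑ b ∈ W.erase v, (M a b : ℂ) * Function.update x v (τ * S) b *
        (Function.update z v (Z / S) b - c) = ∑ b ∈ W.erase v, (M a b : ℂ) * x b * (z b - c) := by
      intro c
      refine Finset.sum_congr rfl fun b hb => ?_
      rw [Function.update_of_ne (Finset.ne_of_mem_erase hb),
        Function.update_of_ne (Finset.ne_of_mem_erase hb)]
    rw [hsum]
    by_cases hav : a = v
    · rw [hav, hM.diag, Function.update_self, sum_mul_sub_eq]
      rw [← hS, ← hZ]
      have e : S * (Z / S) = Z := by field_simp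
      rw [Function.update_self, e]
      simp
    · have hza := hz a (Finset.mem_erase.2 ⟨hav, ha⟩)
      rw [sum_localComplement, sum_mul_sub_eq (M v), ← hS, ← hZ] at hza
      rw [Function.update_self, Function.update_self, Function.update_of_ne hav, hM.symm a v]
      have : (M v a : ℂ) * (τ * S) * (Z / S - z a) = τ * M v a * (Z - S * z a) := by
        field_simp
      rw [this]
      linear_combination hza

/-- A vertex whose row is a multiple of the row of another vertex does not affect rigidity. -/
theorem RigidOn.of_twin {M : V → V → ℝ} (hM : IsWeight M) {W : Finset V} {a b : V} (ha : a ∈ W)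
    (hb : b ∈ W) (hab : a ≠ b) {l : ℝ} (hl : 0 ≤ l) (htw : ∀ c ∈ W, c ≠ a → c ≠ b → M b c = l * M a c)
    (hne : M a b ≠ 0 ∨ (l ≠ 0 ∧ ∃ c ∈ W, c ≠ a ∧ c ≠ b ∧ M a c ≠ 0))
    (h : RigidOn M (W.erase b)) : RigidOn M W := by
  intro x hx z hz
  set U := (W.erase b).erase a with hU
  have hmem : ∀ c, c ∈ U ↔ c ≠ a ∧ c ≠ b ∧ c ∈ W := fun c => by simp [hU]
  have haW : a ∈ W.erase b := Finset.mem_erase.2 ⟨hab, ha⟩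
  have hsplit : ∀ f : V → ℂ, ∑ c ∈ W, f c = f a + f b + ∑ c ∈ U, f c := fun f => by
    rw [← Finset.add_sum_erase _ _ hb, ← Finset.add_sum_erase _ _ haW]
    ring
  -- The twins are merged into one vertex at `a`, with weight `X` and the weighted mean `ζ` as
  -- value. The merged data are harmonic on `W.erase b`.
  set X : ℂ := x a + l * x b with hX
  have hXim : 0 < X.im := by
    have h1 := hx a
    have h2 := mul_nonneg hl (hx b).le
    rw [hX, Complex.add_im, Complex.im_ofReal_mul]
    linarith
  have hX0 : X ≠ 0 := fun e => by simp [e] at hXim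
  set ζ : ℂ := (x a * z a + l * x b * z b) / X with hζ
  have hXζ : X * ζ = x a * z a + l * x b * z b := by rw [hζ]; field_simp
  set S : ℂ := ∑ c ∈ U, (M a c : ℂ) * x c with hS
  set Z : ℂ := ∑ c ∈ U, (M a c : ℂ) * x c * z c with hZ
  have hSim : 0 ≤ S.im := im_sum_nonneg (hM.nonneg a) U hx
  have eqa : M a b * x b * (z b - z a) + (Z - S * z a) = 0 := by
    have := hz a ha
    rw [hsplit, hM.diag, sum_mul_sub_eq, ← hS, ← hZ] at this
    linear_combination this
  have eqb : M a b * x a * (z a - z b) + l * (Z - S * z b) = 0 := by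
    have := hz b hb
    rw [hsplit, hM.diag, hM.symm b a] at this
    have h2 : ∑ c ∈ U, (M b c : ℂ) * x c * (z c - z b) = l * (Z - S * z b) := by
      rw [← sum_mul_sub_eq, Finset.mul_sum]
      refine Finset.sum_congr rfl fun c hc => ?_
      obtain ⟨h1, h2, h3⟩ := (hmem c).1 hc
      rw [htw c h3 h1 h2]
      push_cast
      ring
    rw [h2] at this
    linear_combination this
  have key := h (Function.update x a X) (fun c => ?_) (Function.update z a ζ) fun c hc => ?_
  rotate_left
  · by_cases hc : c = a
    · rw [hc, Function.update_self]
      exact hXim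
    · rw [Function.update_of_ne hc]
      exact hx c
  · rw [← Finset.add_sum_erase _ _ haW]
    have hsum : ∀ t, ∑ d ∈ (W.erase b).erase a, (M c d : ℂ) * Function.update x a X d *
        (Function.update z a ζ d - t) = ∑ d ∈ U, (M c d : ℂ) * x d * (z d - t) := by
      intro t
      refine Finset.sum_congr rfl fun d hd => ?_
      rw [Function.update_of_ne (Finset.ne_of_mem_erase hd),
        Function.update_of_ne (Finset.ne_of_mem_erase hd)]
    rw [hsum]
    by_cases hca : c = a
    · rw [hca, hM.diag, Function.update_self, Function.update_self, sum_mul_sub_eq, ← hS, ← hZ]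
      have : X * (Z - S * ζ) = 0 := by
        linear_combination x a * eqa + x b * eqb - S * hXζ + (Z : ℂ) * hX
      have := (mul_eq_zero.1 this).resolve_left hX0
      linear_combination this
    · have hcb := Finset.ne_of_mem_erase hc
      have hcW := Finset.mem_of_mem_erase hc
      have := hz c hcW
      rw [hsplit, hM.symm c b, htw c hcW hca hcb, hM.symm a c] at this
      rw [Function.update_self, Function.update_self, Function.update_of_ne hca]
      push_cast at this
      linear_combination this + (M c a : ℂ) * hXζ - (M c a : ℂ) * z c * hX
  have hκ : ∀ c ∈ U, z c = ζ := fun c hc => by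
    obtain ⟨h1, h2, h3⟩ := (hmem c).1 hc
    have := key c (Finset.mem_erase.2 ⟨h2, h3⟩) a haW
    rwa [Function.update_self, Function.update_of_ne h1] at this
  have hZS : Z = S * ζ := by
    rw [hZ, hS, Finset.sum_mul]
    exact Finset.sum_congr rfl fun c hc => by rw [hκ c hc]
  -- It remains to separate the twins. Their two equations leave this relation, and `hne` makes the
  -- imaginary part of the first factor positive.
  have hprod : (l * S + M a b * X) * (z b - z a) = 0 := by
    linear_combination l * eqa - eqb + (M a b : ℂ) * (z b - z a) * hX
  have hpos : 0 < (l * S + M a b * X).im := by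
    rw [Complex.add_im, Complex.im_ofReal_mul, Complex.im_ofReal_mul]
    have h1 := mul_nonneg hl hSim
    have h2 := mul_nonneg (hM.nonneg a b) hXim.le
    rcases hne with h3 | ⟨h3, c, hc, hca, hcb, h4⟩
    · have := mul_pos ((hM.nonneg a b).lt_of_ne' h3) hXim
      linarith
    · have := mul_pos (hl.lt_of_ne' h3) (im_sum_pos (hM.nonneg a) (W := U) hx
        ⟨c, (hmem c).2 ⟨hca, hcb, hc⟩, h4⟩)
      linarith
  have hne0 : l * S + M a b * X ≠ 0 := fun e => by simp [e] at hpos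
  have hba : z b = z a := sub_eq_zero.1 ((mul_eq_zero.1 hprod).resolve_left hne0)
  have haζ : z a = ζ := by
    rw [hba] at hXζ
    exact mul_left_cancel₀ hX0 (by linear_combination -hXζ + z a * hX)
  have hall : ∀ c ∈ W, z c = ζ := fun c hc => by
    by_cases h1 : c = a
    · rw [h1, haζ]
    by_cases h2 : c = b
    · rw [h2, hba, haζ]
    exact hκ c ((hmem c).2 ⟨h1, h2, hc⟩)
  exact fun c hc d hd => (hall c hc).trans (hall d hd).symm

/-- After scaling by `s` the weights are invariant under the Klein four-group, so a solution odd
under `(a b)(c d)` is sought: values `1, -1, k, -k`, with weights `ρ * η` on `a, b` and `η` on `c,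
d`. The equations at `a` and `c` determine `k` and leave `ρ ^ 2 + 2 * κ * ρ + 1 = 0`. -/
theorem not_rigidOn_of_klein {M : V → V → ℝ} (hM : IsWeight M) {a b c d : V} (hab : a ≠ b)
    (hac : a ≠ c) (had : a ≠ d) (hbc : b ≠ c) (hbd : b ≠ d) (hcd : c ≠ d) {s : V → ℝ}
    (hs : ∀ v, 0 < s v) {α β γ : ℝ} (hα : 0 < α) (hβ : 0 < β) (hγ : 0 < γ)
    (h1 : s a * s b * M a b = α) (h2 : s c * s d * M c d = α) (h3 : s a * s c * M a c = β)
    (h4 : s b * s d * M b d = β) (h5 : s a * s d * M a d = γ) (h6 : s b * s c * M b c = γ)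
    (hmid : (α - β) * (α - γ) < 0) : ¬RigidOn M {a, b, c, d} := by
  intro h
  set κ : ℝ := (α ^ 2 + β * γ) / (α * (β + γ)) with hκ
  have hden : 0 < α * (β + γ) := by positivity
  have hκ0 : 0 < κ := by positivity
  -- The numerator of `1 - κ` is `-(α - β) * (α - γ)`. Hence the roots `ρ` are nonreal.
  have hκ1 : κ < 1 := by
    rw [hκ, div_lt_one hden]
    nlinarith
  have hκeq : κ * (α * (β + γ)) = α ^ 2 + β * γ := by rw [hκ]; field_simp
  have hβγ : β - γ ≠ 0 := fun e => by
    have : β = γ := sub_eq_zero.1 e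
    rw [this] at hmid
    nlinarith [sq_nonneg (α - γ)]
  set v : ℝ := √(1 - κ ^ 2) with hv
  have hv2 : v ^ 2 = 1 - κ ^ 2 := Real.sq_sqrt (by nlinarith)
  have hv0 : 0 < v := Real.sqrt_pos.2 (by nlinarith)
  set ρ : ℂ := -κ + v * Complex.I with hρ
  have hρeq : ρ ^ 2 + 2 * κ * ρ + 1 = 0 := by
    have h : ((v : ℂ)) ^ 2 = 1 - κ ^ 2 := by exact_mod_cast hv2
    rw [hρ]
    linear_combination -h + (v : ℂ) ^ 2 * Complex.I_sq
  -- Chosen so that both `η` and `ρ * η` have imaginary part `1`.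
  set η : ℂ := ((1 + κ) / v : ℝ) + Complex.I with hη
  have hηim : 0 < η.im := by simp [hη]
  have hρηim : 0 < (ρ * η).im := by
    have : (ρ * η).im = 1 := by
      simp only [hρ, hη, Complex.mul_im, Complex.add_re, Complex.add_im, Complex.neg_re,
        Complex.neg_im, Complex.ofReal_re, Complex.ofReal_im, Complex.mul_re, Complex.I_re,
        Complex.I_im]
      field_simp
      ring
    rw [this]
    exact one_pos
  have hβγ' : (β : ℂ) - γ ≠ 0 := by exact_mod_cast hβγ
  set k : ℂ := (β + γ + 2 * α * ρ) / (β - γ) with hk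
  have hkeq : k * (β - γ) = β + γ + 2 * α * ρ := by rw [hk]; field_simp
  have hκeq' : (κ : ℂ) * (α * (β + γ)) = α ^ 2 + β * γ := by exact_mod_cast hκeq
  have eq2 : ρ * ((β - γ) - (β + γ) * k) = 2 * α * k := by
    apply mul_right_cancel₀ hβγ'
    linear_combination (-(ρ * (β + γ)) - 2 * α) * hkeq - 2 * α * (β + γ) * hρeq
      + 4 * ρ * hκeq'
  set x : V → ℂ := fun u => s u * if u = a ∨ u = b then ρ * η else η with hx
  set z : V → ℂ := fun u => if u = a then 1 else if u = b then -1 else if u = c then k else -k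
    with hz
  have key := h x (fun u => ?_) z fun u hu => ?_
  · have := key a (by simp) b (by simp)
    simp only [hz, if_true, hab.symm, if_false] at this
    norm_num at this
  · rw [hx, Complex.im_ofReal_mul]
    split_ifs
    · exact mul_pos (hs u) hρηim
    · exact mul_pos (hs u) hηim
  · have xa : x a = s a * (ρ * η) := by simp [hx]
    have xb : x b = s b * (ρ * η) := by simp [hx]
    have xc : x c = s c * η := by simp [hx, hac.symm, hbc.symm]
    have xd : x d = s d * η := by simp [hx, had.symm, hbd.symm]
    have za : z a = 1 := by simp [hz]
    have zb : z b = -1 := by simp [hz, hab.symm]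
    have zc : z c = k := by simp [hz, hac.symm, hbc.symm]
    have zd : z d = -k := by simp [hz, had.symm, hbd.symm, hcd.symm]
    have hsum : ∀ f : V → ℂ, ∑ e ∈ ({a, b, c, d} : Finset V), f e = f a + f b + f c + f d := by
      intro f
      rw [Finset.sum_insert (by simp [hab, hac, had]), Finset.sum_insert (by simp [hbc, hbd]),
        Finset.sum_insert (by simp [hcd]), Finset.sum_singleton]
      ring
    have g1 : (s a * s b * M a b : ℂ) = α := by exact_mod_cast h1
    have g2 : (s c * s d * M c d : ℂ) = α := by exact_mod_cast h2
    have g3 : (s a * s c * M a c : ℂ) = β := by exact_mod_cast h3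
    have g4 : (s b * s d * M b d : ℂ) = β := by exact_mod_cast h4
    have g5 : (s a * s d * M a d : ℂ) = γ := by exact_mod_cast h5
    have g6 : (s b * s c * M b c : ℂ) = γ := by exact_mod_cast h6
    have hsu : (s u : ℂ) ≠ 0 := by exact_mod_cast (hs u).ne'
    rw [hsum, xa, xb, xc, xd, za, zb, zc, zd]
    apply mul_left_cancel₀ hsu
    rw [mul_zero]
    simp only [Finset.mem_insert, Finset.mem_singleton] at hu
    rcases hu with rfl | rfl | rfl | rfl
    · rw [za]
      linear_combination (-2 * ρ * η) * g1 + η * (k - 1) * g3 + η * (-k - 1) * g5 + η * hkeq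
    · rw [zb, hM.symm u a]
      linear_combination (2 * ρ * η) * g1 + η * (-k + 1) * g4 + η * (k + 1) * g6 - η * hkeq
    · rw [zc, hM.symm u a, hM.symm u b, hM.diag]
      push_cast
      linear_combination (-2 * k * η) * g2 + ρ * η * (1 - k) * g3 + ρ * η * (-1 - k) * g6
        + η * eq2
    · rw [zd, hM.symm u a, hM.symm u b, hM.symm u c, hM.diag]
      push_cast
      linear_combination (2 * k * η) * g2 + ρ * η * (k - 1) * g4 + ρ * η * (1 + k) * g5
        - η * eq2

end Operations

/-! ### The four-point condition -/

section Quadruples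

variable {V : Type*}

/-- Of the three products of weights of perfect matchings on four vertices two are equal. -/
def FourPoint (M : V → V → ℝ) (a b c d : V) : Prop :=
  M a b * M c d = M a c * M b d ∨ M a c * M b d = M a d * M b c ∨ M a b * M c d = M a d * M b c

/-- Scaling vertices multiplies all three matching products by the same factor. It can be chosen to
equalise opposite edges, whose common values are then the square roots of the products. -/
theorem not_rigidOn_of_middle {M : V → V → ℝ} (hM : IsWeight M) (hpos : ∀ a b, a ≠ b → 0 < M a b)
    {a b c d : V} (hab : a ≠ b) (hac : a ≠ c) (had : a ≠ d) (hbc : b ≠ c) (hbd : b ≠ d)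
    (hcd : c ≠ d)
    (hmid : (M a b * M c d - M a c * M b d) * (M a b * M c d - M a d * M b c) < 0) :
    ¬RigidOn M {a, b, c, d} := by
  have mab := hpos _ _ hab
  have mac := hpos _ _ hac
  have mad := hpos _ _ had
  have mbc := hpos _ _ hbc
  have mbd := hpos _ _ hbd
  have mcd := hpos _ _ hcd
  have hp : 0 < M a b * M c d := by positivity
  have hq : 0 < M a c * M b d := by positivity
  have hr : 0 < M a d * M b c := by positivity
  set α := √(M a b * M c d) with hα
  set β := √(M a c * M b d) with hβ
  set γ := √(M a d * M b c) with hγ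
  have α2 : α ^ 2 = M a b * M c d := Real.sq_sqrt hp.le
  have β2 : β ^ 2 = M a c * M b d := Real.sq_sqrt hq.le
  have γ2 : γ ^ 2 = M a d * M b c := Real.sq_sqrt hr.le
  have α0 : 0 < α := Real.sqrt_pos.2 hp
  have β0 : 0 < β := Real.sqrt_pos.2 hq
  have γ0 : 0 < γ := Real.sqrt_pos.2 hr
  -- With `s a = t`, the three edges at `a` force the other scalings, and the edge `b c` then forces
  -- `t ^ 2`.
  set t := √(α * β * M b c / (γ * M a b * M a c)) with ht
  have t0 : 0 < t := Real.sqrt_pos.2 (by positivity)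
  have t2 : t ^ 2 = α * β * M b c / (γ * M a b * M a c) := Real.sq_sqrt (by positivity)
  have t2' : t ^ 2 * (γ * M a b * M a c) = α * β * M b c := by rw [t2]; field_simp
  set s : V → ℝ := fun v => if v = a then t else if v = b then α / (M a b * t) else
    if v = c then β / (M a c * t) else γ / (M a d * t) with hs
  have sa : s a = t := by simp [hs]
  have sb : s b = α / (M a b * t) := by simp [hs, hab.symm]
  have sc : s c = β / (M a c * t) := by simp [hs, hac.symm, hbc.symm]
  have sd : s d = γ / (M a d * t) := by simp [hs, had.symm, hbd.symm, hcd.symm]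
  refine not_rigidOn_of_klein hM hab hac had hbc hbd hcd (s := s) (fun v => ?_) α0 β0 γ0
    ?_ ?_ ?_ ?_ ?_ ?_ ?_
  · simp only [hs]
    split_ifs <;> positivity
  · rw [sa, sb]; field_simp
  · rw [sc, sd]
    field_simp
    apply mul_left_cancel₀ (mul_pos mab γ0).ne'
    linear_combination (γ ^ 2 * β) * α2.symm - α * M a d * t2' + α ^ 2 * β * γ2
  · rw [sa, sc]; field_simp
  · rw [sb, sd]
    field_simp
    apply mul_left_cancel₀ (mul_pos mac γ0).ne'
    linear_combination (γ ^ 2 * α) * β2.symm - β * M a d * t2' + β ^ 2 * α * γ2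
  · rw [sa, sd]; field_simp
  · rw [sb, sc]
    field_simp
    linear_combination -t2'
  · have e1 : α ^ 2 - β ^ 2 = (α - β) * (α + β) := by ring
    have e2 : α ^ 2 - γ ^ 2 = (α - γ) * (α + γ) := by ring
    rw [← α2, ← β2, ← γ2, e1, e2] at hmid
    by_contra! hcon
    have := mul_nonneg hcon (mul_pos (add_pos α0 β0) (add_pos α0 γ0)).le
    linarith

/-- Three distinct products would have a middle one, and each possible middle is excluded. -/
theorem fourPoint_of_rigidOn_four {M : V → V → ℝ} (hM : IsWeight M)
    (hpos : ∀ a b, a ≠ b → 0 < M a b) {a b c d : V} (hab : a ≠ b) (hac : a ≠ c) (had : a ≠ d)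
    (hbc : b ≠ c) (hbd : b ≠ d) (hcd : c ≠ d) (h : RigidOn M {a, b, c, d}) :
    FourPoint M a b c d := by
  have h2 : RigidOn M {a, c, b, d} := by
    rwa [show ({a, c, b, d} : Finset V) = {a, b, c, d} by ext; simp; tauto]
  have h3 : RigidOn M {a, d, b, c} := by
    rwa [show ({a, d, b, c} : Finset V) = {a, b, c, d} by ext; simp; tauto]
  have k1 := mt (not_rigidOn_of_middle hM hpos hab hac had hbc hbd hcd) (not_not.2 h)
  have k2 := mt (not_rigidOn_of_middle hM hpos hac hab had hbc.symm hcd hbd) (not_not.2 h2)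
  have k3 := mt (not_rigidOn_of_middle hM hpos had hab hac hbd.symm hcd.symm hbc) (not_not.2 h3)
  rw [hM.symm c b] at k2
  rw [hM.symm d b, hM.symm d c] at k3
  push Not at k1 k2 k3
  unfold FourPoint
  by_contra! hcon
  obtain ⟨n1, n2, n3⟩ := hcon
  generalize M a b * M c d = p at *
  generalize M a c * M b d = q at *
  generalize M a d * M b c = r at *
  rcases lt_or_gt_of_ne n1 with c1 | c1 <;> rcases lt_or_gt_of_ne n2 with c2 | c2 <;>
    rcases lt_or_gt_of_ne n3 with c3 | c3 <;> nlinarith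

theorem FourPoint.mul_eq_zero {M : V → V → ℝ} {a b c d : V} (h : FourPoint M a b c d) :
    (M a b * M c d - M a c * M b d) * (M a c * M b d - M a d * M b c) *
      (M a b * M c d - M a d * M b c) = 0 := by
  rcases h with h | h | h <;> rw [h] <;> ring

/-- Eliminating a vertex outside the quadruple gives the condition for the complemented weights, for
every `τ > 0`. Written as the vanishing of a product of differences, it is continuous in `τ` and
survives at `τ = 0`. -/
theorem fourPoint_of_rigidOn {W : Finset V} : ∀ {M : V → V → ℝ}, IsWeight M →
    (∀ a b, a ≠ b → 0 < M a b) → RigidOn M W → ∀ {a b c d : V}, a ∈ W → b ∈ W → c ∈ W → d ∈ W →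
    a ≠ b → a ≠ c → a ≠ d → b ≠ c → b ≠ d → c ≠ d → FourPoint M a b c d := by
  induction W using Finset.strongInduction with
  | H W ih =>
    intro M hM hpos h a b c d ha hb hc hd hab hac had hbc hbd hcd
    by_cases hW : W = {a, b, c, d}
    · rw [hW] at h
      exact fourPoint_of_rigidOn_four hM hpos hab hac had hbc hbd hcd h
    · obtain ⟨v, hv, hv'⟩ : ∃ v ∈ W, v ∉ ({a, b, c, d} : Finset V) := by
        by_contra! hcon
        refine hW (Finset.Subset.antisymm hcon ?_)
        intro u hu
        simp only [Finset.mem_insert, Finset.mem_singleton] at hu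
        rcases hu with rfl | rfl | rfl | rfl <;> assumption
      simp only [Finset.mem_insert, Finset.mem_singleton, not_or] at hv'
      obtain ⟨va, vb, vc, vd⟩ := hv'
      set F : ℝ → ℝ := fun τ =>
        ((M a b + τ * M v a * M v b) * (M c d + τ * M v c * M v d) -
          (M a c + τ * M v a * M v c) * (M b d + τ * M v b * M v d)) *
        ((M a c + τ * M v a * M v c) * (M b d + τ * M v b * M v d) -
          (M a d + τ * M v a * M v d) * (M b c + τ * M v b * M v c)) *
        ((M a b + τ * M v a * M v b) * (M c d + τ * M v c * M v d) -
          (M a d + τ * M v a * M v d) * (M b c + τ * M v b * M v c)) with hF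
      have hF0 : ∀ τ ∈ Set.Ioi (0 : ℝ), F τ = 0 := by
        intro τ hτ
        have hτ : 0 < τ := hτ
        have := (ih (W.erase v) (Finset.erase_ssubset hv) (hM.localComplement v hτ.le)
          (fun x y hxy => (hpos x y hxy).trans_le (hM.le_localComplement v hτ.le x y))
          (h.eliminate hM hv hτ ⟨a, Finset.mem_erase.2 ⟨Ne.symm va, ha⟩, (hpos v a va).ne'⟩)
          (Finset.mem_erase.2 ⟨Ne.symm va, ha⟩) (Finset.mem_erase.2 ⟨Ne.symm vb, hb⟩)
          (Finset.mem_erase.2 ⟨Ne.symm vc, hc⟩) (Finset.mem_erase.2 ⟨Ne.symm vd, hd⟩)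
          hab hac had hbc hbd hcd).mul_eq_zero
        rwa [localComplement_of_ne M v τ hab, localComplement_of_ne M v τ hac,
          localComplement_of_ne M v τ had, localComplement_of_ne M v τ hbc,
          localComplement_of_ne M v τ hbd, localComplement_of_ne M v τ hcd] at this
      have hcont : Continuous F := by fun_prop
      have h0 : F 0 = 0 := by
        have := Set.EqOn.closure (f := F) (g := fun _ => 0) hF0 hcont continuous_const
        rw [closure_Ioi] at this
        exact this (Set.mem_Ici.2 le_rfl)
      simp only [hF, zero_mul, add_zero, _root_.mul_eq_zero, sub_eq_zero] at h0
      unfold FourPoint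
      tauto

end Quadruples

/-! ### Reduction to positive off-diagonal weights -/

section Positive

variable {V : Type*}

/-- The `2 × 2` minors of the submatrix of `M` with rows `A` and columns `Aᶜ` vanish. -/
def CutMinorsVanish (M : V → V → ℝ) (A : Set V) : Prop :=
  ∀ a ∈ A, ∀ a' ∈ A, ∀ b ∉ A, ∀ b' ∉ A, M a b * M a' b' = M a b' * M a' b

theorem CutMinorsVanish.compl {M : V → V → ℝ} (hM : IsWeight M) {A : Set V}
    (h : CutMinorsVanish M A) : CutMinorsVanish M Aᶜ := by
  intro a ha a' ha' b hb b' hb'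
  rw [Set.notMem_compl_iff] at hb hb'
  rw [hM.symm a b, hM.symm a' b', hM.symm a b', hM.symm a' b, h b hb b' hb' a ha a' ha', mul_comm]

/-- The row of `v` is unchanged, and every other row across the cut gains a multiple of it. Undoing
these row operations recovers the minors of `M`. -/
theorem CutMinorsVanish.of_localComplement_of_mem {M : V → V → ℝ} (hM : IsWeight M) {v : V} {τ : ℝ}
    {A : Set V} (hv : v ∈ A) (h : CutMinorsVanish (localComplement M v τ) A) :
    CutMinorsVanish M A := by
  have key : ∀ a ∈ A, ∀ b ∉ A, localComplement M v τ a b = M a b + τ * M v a * M v b :=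
    fun a ha b hb => localComplement_of_ne M v τ fun e => hb (e ▸ ha)
  intro a ha a' ha' b hb b' hb'
  have h1 := h a ha a' ha' b hb b' hb'
  have h2 := h a ha v hv b hb b' hb'
  have h3 := h v hv a' ha' b hb b' hb'
  rw [key a ha b hb, key a' ha' b' hb', key a ha b' hb', key a' ha' b hb] at h1
  rw [key a ha b hb, key a ha b' hb', hM.localComplement_self, hM.localComplement_self] at h2
  rw [key a' ha' b hb, key a' ha' b' hb', hM.localComplement_self, hM.localComplement_self] at h3
  linear_combination h1 - τ * M v a' * h2 - τ * M v a * h3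

theorem CutMinorsVanish.of_localComplement {M : V → V → ℝ} (hM : IsWeight M) {v : V} {τ : ℝ}
    (hτ : 0 ≤ τ) {A : Set V} (h : CutMinorsVanish (localComplement M v τ) A) :
    CutMinorsVanish M A := by
  by_cases hv : v ∈ A
  · exact h.of_localComplement_of_mem hM hv
  · rw [← compl_compl A]
    exact ((h.compl (hM.localComplement v hτ)).of_localComplement_of_mem hM hv).compl hM

/-- The graph of the nonzero entries of `M` within `W` is connected. -/
def ConnectedOn (M : V → V → ℝ) (W : Finset V) : Prop :=
  ∀ A : Set V, (∃ a ∈ W, a ∈ A) → (∃ b ∈ W, b ∉ A) → ∃ a ∈ W, ∃ b ∈ W, a ∈ A ∧ b ∉ A ∧ M a b ≠ 0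

/-- Complementing at the middle `v` of a path `b, v, d` with `M b d = 0` makes that entry positive
and destroys no positive entry, so the number of off-diagonal zeros drops. -/
theorem exists_positive_of_rigidOn [Fintype V] {M : V → V → ℝ} (hM : IsWeight M)
    (hconn : ConnectedOn M Finset.univ) (h : RigidOn M Finset.univ) :
    ∃ N : V → V → ℝ, IsWeight N ∧ (∀ a b, a ≠ b → 0 < N a b) ∧ RigidOn N Finset.univ ∧
      ∀ A, CutMinorsVanish N A → CutMinorsVanish M A := by
  generalize hn : (Finset.univ.filter fun p : V × V => p.1 ≠ p.2 ∧ M p.1 p.2 = 0).card = n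
  induction n using Nat.strong_induction_on generalizing M with
  | _ n ih =>
    by_cases hpos : ∀ a b, a ≠ b → 0 < M a b
    · exact ⟨M, hM, hpos, h, fun _ => id⟩
    push Not at hpos
    obtain ⟨b, c, hbc, hle⟩ := hpos
    have h0 : M b c = 0 := le_antisymm hle (hM.nonneg b c)
    -- Connectedness gives an edge leaving the closed neighbourhood of `b`.
    obtain ⟨v, -, d, -, hv, hd, hvd⟩ := hconn {u | u = b ∨ M b u ≠ 0}
      ⟨b, Finset.mem_univ _, Or.inl rfl⟩ ⟨c, Finset.mem_univ _, by simp [hbc.symm, h0]⟩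
    simp only [Set.mem_ofPred_eq, not_or, not_not] at hv hd
    have hvb : M b v ≠ 0 := by
      rcases hv with rfl | hv
      · exact absurd hd.2 hvd
      · exact hv
    have hM' := hM.localComplement v zero_le_one
    have hmono := hM.le_localComplement v zero_le_one
    have hnz : ∀ x y, M x y ≠ 0 → localComplement M v 1 x y ≠ 0 := fun x y hxy =>
      (((hM.nonneg x y).lt_of_ne' hxy).trans_le (hmono x y)).ne'
    have hdb : d ≠ b := hd.1
    have hcard : (Finset.univ.filter fun p : V × V => p.1 ≠ p.2 ∧
        localComplement M v 1 p.1 p.2 = 0).card < n := by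
      rw [← hn]
      refine Finset.card_lt_card (Finset.ssubset_iff_of_subset ?_ |>.2 ⟨(b, d), ?_, ?_⟩)
      · intro p hp
        simp only [Finset.mem_filter, Finset.mem_univ, true_and] at hp ⊢
        exact ⟨hp.1, by_contra fun e => hnz _ _ e hp.2⟩
      · simpa using ⟨hdb.symm, hd.2⟩
      · simp only [Finset.mem_filter, Finset.mem_univ, true_and, not_and]
        intro _
        rw [localComplement_of_ne M v 1 hdb.symm, hd.2, hM.symm v b]
        simpa using ⟨hvb, hvd⟩
    have hconn' : ConnectedOn (localComplement M v 1) Finset.univ := by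
      intro A hA hB
      obtain ⟨x, hx, y, hy, hxA, hyA, hxy⟩ := hconn A hA hB
      exact ⟨x, hx, y, hy, hxA, hyA, hnz x y hxy⟩
    obtain ⟨N, h1, h2, h3, h4⟩ := ih _ hcard hM' hconn' (h.localComplement hM (Finset.mem_univ v)
      zero_le_one) rfl
    exact ⟨N, h1, h2, h3, fun A hA => (h4 A hA).of_localComplement hM zero_le_one⟩

end Positive

/-! ### Splits and twins in symbolic ultrametrics -/

section SymbolicUltrametric

variable {V C : Type*}

/-- The hypotheses of the theorem of Böcker and Dress: no triangle of `U` has three different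
values, and no four elements carry two values forming complementary paths. -/
structure IsSymbolicUltrametric (δ : V → V → C) (U : Finset V) : Prop where
  symm : ∀ a b, δ a b = δ b a
  triangle : ∀ a ∈ U, ∀ b ∈ U, ∀ c ∈ U, a ≠ b → a ≠ c → b ≠ c →
    δ a b = δ a c ∨ δ a b = δ b c ∨ δ a c = δ b c
  path : ∀ a ∈ U, ∀ b ∈ U, ∀ c ∈ U, ∀ d ∈ U, a ≠ b → a ≠ c → a ≠ d → b ≠ c → b ≠ d → c ≠ d →
    δ a b = δ b c → δ b c = δ c d → δ a c = δ a d → δ a d = δ b d → δ a b = δ a c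

theorem IsSymbolicUltrametric.mono {δ : V → V → C} {U U' : Finset V}
    (h : IsSymbolicUltrametric δ U) (hU : U' ⊆ U) : IsSymbolicUltrametric δ U' where
  symm := h.symm
  triangle a ha b hb c hc := h.triangle a (hU ha) b (hU hb) c (hU hc)
  path a ha b hb c hc d hd := h.path a (hU ha) b (hU hb) c (hU hc) d (hU hd)

/-- Add a point `u` to a set already split with value `α`, and take the classes `E` generated by
pairs of value other than `α`; there are at least two. A class seen by `u` only with value `α`
splits off. Otherwise triangles across classes force all values at `u` other than `α` to be equal.
Then either `{u}` splits off or a forbidden pair of paths appears. -/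
theorem IsSymbolicUltrametric.exists_split {δ : V → V → C} {U : Finset V} :
    IsSymbolicUltrametric δ U → 2 ≤ U.card →
    ∃ A ⊆ U, A.Nonempty ∧ A ≠ U ∧ ∃ α, ∀ a ∈ A, ∀ b ∈ U, b ∉ A → δ a b = α := by
  induction U using Finset.induction_on with
  | empty => simp
  | insert u U hu ih =>
    intro h hcard
    rw [Finset.card_insert_of_notMem hu] at hcard
    have huU : {u} ≠ insert u U := fun e => by
      have := congrArg Finset.card e
      rw [Finset.card_insert_of_notMem hu, Finset.card_singleton] at this
      omega
    have hne : ∀ x ∈ U, u ≠ x := fun x hx e => hu (e ▸ hx)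
    have single : ∀ β, (∀ y ∈ U, δ u y = β) → ∃ A ⊆ insert u U, A.Nonempty ∧ A ≠ insert u U ∧
        ∃ α, ∀ a ∈ A, ∀ b ∈ insert u U, b ∉ A → δ a b = α := by
      intro β hβ
      refine ⟨{u}, by simp, by simp, huU, β, ?_⟩
      intro a ha b hb hba
      rw [Finset.mem_singleton] at ha hba
      rw [ha]
      exact hβ b ((Finset.mem_insert.1 hb).resolve_left hba)
    by_cases hU2 : 2 ≤ U.card
    swap
    · obtain ⟨x, hx⟩ := Finset.card_eq_one.1 (show U.card = 1 by omega)
      exact single (δ u x) fun y hy => by rw [hx, Finset.mem_singleton] at hy; rw [hy]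
    obtain ⟨A, hAU, ⟨a₀, ha₀⟩, hAne, α, hα⟩ := ih (h.mono (Finset.subset_insert _ _)) hU2
    obtain ⟨b₀, hb₀U, hb₀⟩ : ∃ b ∈ U, b ∉ A := by
      by_contra! hcon
      exact hAne (Finset.Subset.antisymm hAU hcon)
    set R : V → V → Prop := fun x y => x ∈ U ∧ y ∈ U ∧ x ≠ y ∧ δ x y ≠ α with hR
    have hRsymm : ∀ x y, R x y → R y x := fun x y hxy =>
      ⟨hxy.2.1, hxy.1, hxy.2.2.1.symm, by rw [h.symm]; exact hxy.2.2.2⟩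
    set E := Relation.ReflTransGen R with hE
    have hEsymm : ∀ {x y}, E x y → E y x := fun hxy =>
      haveI : Std.Symm R := ⟨hRsymm⟩
      Std.Symm.symm _ _ hxy
    have hEU : ∀ {x y}, E x y → x ∈ U → y ∈ U := by
      intro x y hxy hx
      induction hxy with
      | refl => exact hx
      | tail _ hyz _ => exact hyz.2.1
    have hnotE : ∀ {x y}, x ∈ U → y ∈ U → ¬E x y → δ x y = α := by
      intro x y hx hy hxy
      by_contra hne
      refine hxy (Relation.ReflTransGen.single ⟨hx, hy, ?_, hne⟩)
      rintro rfl
      exact hxy Relation.ReflTransGen.refl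
    have hEA : ∀ {x y}, E x y → x ∈ U → (x ∈ A ↔ y ∈ A) := by
      intro x y hxy hx
      induction hxy with
      | refl => rfl
      | tail _ hyz ih' =>
        rw [ih']
        obtain ⟨h1, h2, -, h4⟩ := hyz
        constructor
        · intro h5
          by_contra h6
          exact h4 (hα _ h5 _ h2 h6)
        · intro h5
          by_contra h6
          exact h4 (by rw [h.symm]; exact hα _ h5 _ h1 h6)
    have hother : ∀ x ∈ U, ∃ w ∈ U, ¬E x w := by
      intro x hx
      by_cases hxA : x ∈ A
      · exact ⟨b₀, hb₀U, fun e => hb₀ ((hEA e hx).1 hxA)⟩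
      · exact ⟨a₀, hAU ha₀, fun e => hxA ((hEA e hx).2 ha₀)⟩
    by_cases hcase : ∃ x ∈ U, ∀ y, E x y → δ u y = α
    · obtain ⟨x, hx, hxα⟩ := hcase
      obtain ⟨w, hw, hxw⟩ := hother x hx
      refine ⟨U.filter (E x), ?_, ⟨x, ?_⟩, ?_, α, ?_⟩
      · exact (Finset.filter_subset _ _).trans (Finset.subset_insert _ _)
      · exact Finset.mem_filter.2 ⟨hx, Relation.ReflTransGen.refl⟩
      · intro e
        have : u ∈ U.filter (E x) := e ▸ Finset.mem_insert_self u U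
        exact hu (Finset.mem_filter.1 this).1
      · intro a ha b hb hba
        obtain ⟨haU, hxa⟩ := Finset.mem_filter.1 ha
        rcases Finset.mem_insert.1 hb with rfl | hbU
        · rw [h.symm]
          exact hxα a hxa
        · exact hnotE haU hbU fun e => hba (Finset.mem_filter.2 ⟨hbU, hxa.trans e⟩)
    push Not at hcase
    have htri : ∀ x ∈ U, ∀ y ∈ U, x ≠ y → δ u x = δ u y ∨ δ u x = δ x y ∨ δ u y = δ x y :=
      fun x hx y hy hxy => h.triangle u (Finset.mem_insert_self _ _) x (Finset.mem_insert_of_mem hx)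
        y (Finset.mem_insert_of_mem hy) (hne x hx) (hne y hy) hxy
    have hcross : ∀ x ∈ U, ∀ y ∈ U, ¬E x y → δ u x ≠ α → δ u y ≠ α → δ u x = δ u y := by
      intro x hx y hy hxy h1 h2
      have hne' : x ≠ y := fun e => hxy (e ▸ Relation.ReflTransGen.refl)
      have := htri x hx y hy hne'
      rw [hnotE hx hy hxy] at this
      tauto
    have hfar : ∀ x ∈ U, ∃ c ∈ U, ¬E x c ∧ δ u c ≠ α := by
      intro x hx
      obtain ⟨w, hw, hxw⟩ := hother x hx
      obtain ⟨c, hwc, hc⟩ := hcase w hw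
      exact ⟨c, hEU hwc hw, fun e => hxw (e.trans (hEsymm hwc)), hc⟩
    have hsame : ∀ x ∈ U, ∀ y ∈ U, δ u x ≠ α → δ u y ≠ α → δ u x = δ u y := by
      intro x hx y hy h1 h2
      by_cases hxy : E x y
      · obtain ⟨c, hc, hxc, hcα⟩ := hfar x hx
        exact (hcross x hx c hc hxc h1 hcα).trans
          (hcross y hy c hc (fun e => hxc (hxy.trans e)) h2 hcα).symm
      · exact hcross x hx y hy hxy h1 h2
    obtain ⟨y₀, hay₀, hy₀α⟩ := hcase a₀ (hAU ha₀)
    have hy₀ := hEU hay₀ (hAU ha₀)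
    by_cases hall : ∀ y ∈ U, δ u y ≠ α
    · exact single (δ u y₀) fun y hy => hsame y hy y₀ hy₀ (hall y hy) hy₀α
    exfalso
    push Not at hall
    obtain ⟨x, hx, hxα⟩ := hall
    obtain ⟨y, hxy, hyα⟩ := hcase x hx
    -- A chain within the class from value `α` to another value at `u` must switch somewhere.
    obtain ⟨p, q, hxp, hpq, hpα, hqα⟩ : ∃ p q, E x p ∧ R p q ∧ δ u p = α ∧ δ u q ≠ α := by
      induction hxy with
      | refl => exact absurd hxα hyα
      | tail hxb hbc ih' =>
        rename_i b c
        by_cases hb : δ u b = α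
        · exact ⟨b, c, hxb, hbc, hb, hyα⟩
        · exact ih' hb
    obtain ⟨hp, hq, hpq', hpqα⟩ := hpq
    have hpqβ : δ p q = δ u q := by
      rcases htri p hp q hq hpq' with h1 | h1 | h1
      · exact absurd (h1.symm.trans hpα) hqα
      · exact absurd (h1.symm.trans hpα) hpqα
      · exact h1.symm
    obtain ⟨c, hc, hpc, hcα⟩ := hfar p hp
    have hEpq : E p q := Relation.ReflTransGen.single ⟨hp, hq, hpq', hpqα⟩
    have hcq : ¬E q c := fun e => hpc (hEpq.trans e)
    have h1 : δ c q = α := by rw [h.symm]; exact hnotE hq hc hcq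
    have h2 : δ c p = α := by rw [h.symm]; exact hnotE hp hc hpc
    have hcu : δ c u = δ u q := by rw [h.symm]; exact hsame c hc q hq hcα hqα
    -- The path `c, u, q, p` carries the value `δ u q`, while its three complementary pairs carry
    -- `α`.
    have := h.path c (Finset.mem_insert_of_mem hc) u (Finset.mem_insert_self _ _) q
      (Finset.mem_insert_of_mem hq) p (Finset.mem_insert_of_mem hp) (hne c hc).symm
      (fun e => hcq (e ▸ Relation.ReflTransGen.refl)) (fun e => hpc (e ▸ Relation.ReflTransGen.refl))
      (hne q hq) (hne p hp) hpq'.symm hcu (by rw [h.symm q p, hpqβ]) (h1.trans h2.symm)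
      (h2.trans hpα.symm)
    exact hqα (hcu.symm.trans (this.trans h1))

/-- Points outside one part of a split cannot distinguish points inside it. So twins of a part with
at least two elements are twins in the whole set. -/
theorem IsSymbolicUltrametric.exists_twins {δ : V → V → C} {U : Finset V} :
    IsSymbolicUltrametric δ U → 2 ≤ U.card →
    ∃ a ∈ U, ∃ b ∈ U, a ≠ b ∧ ∀ c ∈ U, c ≠ a → c ≠ b → δ a c = δ b c := by
  induction U using Finset.strongInduction with
  | H U ih =>
    intro h hcard
    obtain ⟨A, hAU, hA, hAne, α, hα⟩ := h.exists_split hcard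
    have hss : A ⊂ U := ⟨hAU, fun e => hAne (Finset.Subset.antisymm hAU e)⟩
    have hA1 : 1 ≤ A.card := hA.card_pos
    have hsd : (U \ A).card + A.card = U.card := Finset.card_sdiff_add_card_eq_card hAU
    have hlt := Finset.card_lt_card hss
    by_cases hA2 : 2 ≤ A.card
    · obtain ⟨a, ha, b, hb, hab, htw⟩ := ih A hss (h.mono hAU) hA2
      refine ⟨a, hAU ha, b, hAU hb, hab, fun c hc hca hcb => ?_⟩
      by_cases hcA : c ∈ A
      · exact htw c hcA hca hcb
      · rw [hα a ha c hc hcA, hα b hb c hc hcA]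
    by_cases hB2 : 2 ≤ (U \ A).card
    · obtain ⟨a, ha, b, hb, hab, htw⟩ := ih (U \ A) (Finset.sdiff_ssubset hAU hA)
        (h.mono Finset.sdiff_subset) hB2
      rw [Finset.mem_sdiff] at ha hb
      refine ⟨a, ha.1, b, hb.1, hab, fun c hc hca hcb => ?_⟩
      by_cases hcA : c ∈ A
      · rw [h.symm a, h.symm b, hα c hcA a ha.1 ha.2, hα c hcA b hb.1 hb.2]
      · exact htw c (Finset.mem_sdiff.2 ⟨hc, hcA⟩) hca hcb
    · obtain ⟨a, b, hab, hU⟩ := Finset.card_eq_two.1 (show U.card = 2 by omega)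
      refine ⟨a, by simp [hU], b, by simp [hU], hab, fun c hc hca hcb => ?_⟩
      rw [hU] at hc
      simp [hca, hcb] at hc

end SymbolicUltrametric

/-! ### Proportional rows from the four-point condition -/

section Cherry

variable {V : Type*}

/-- For `δ a b = M a b / (M r a * M r b)`, the four-point condition on `r, a, b, c` is the triangle
axiom, and on quadruples avoiding `r` it gives the path axiom. Twins for `δ` have `M`-rows with
ratio `M r b / M r a`. -/
theorem exists_cherry_of_fourPoint {M : V → V → ℝ} (hM : IsWeight M)
    (hpos : ∀ a b, a ≠ b → 0 < M a b) {W : Finset V} (hW : 3 ≤ W.card)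
    (h4 : ∀ {a b c d : V}, a ∈ W → b ∈ W → c ∈ W → d ∈ W →
      a ≠ b → a ≠ c → a ≠ d → b ≠ c → b ≠ d → c ≠ d → FourPoint M a b c d) :
    ∃ a ∈ W, ∃ b ∈ W, a ≠ b ∧ ∃ l, 0 < l ∧ ∀ c ∈ W, c ≠ a → c ≠ b → M b c = l * M a c := by
  obtain ⟨r, hr⟩ : W.Nonempty := Finset.card_pos.1 (by omega)
  set δ : V → V → ℝ := fun a b => M a b / (M r a * M r b) with hδ
  have hU : IsSymbolicUltrametric δ (W.erase r) := by
    refine ⟨fun a b => by simp only [hδ]; rw [hM.symm a b, mul_comm (M r a)], ?_, ?_⟩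
    · intro a ha b hb c hc hab hac hbc
      obtain ⟨ra, ha⟩ := Finset.mem_erase.1 ha
      obtain ⟨rb, hb⟩ := Finset.mem_erase.1 hb
      obtain ⟨rc, hc⟩ := Finset.mem_erase.1 hc
      have pa := hpos r a ra.symm
      have pb := hpos r b rb.symm
      have pc := hpos r c rc.symm
      simp only [hδ]
      rcases h4 hr ha hb hc ra.symm rb.symm rc.symm hab hac hbc with h | h | h
      · right; right
        field_simp
        linarith
      · left
        field_simp
        linarith
      · right; left
        field_simp
        linarith
    · intro a ha b hb c hc d hd hab hac had hbc hbd hcd e1 e2 e3 e4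
      obtain ⟨ra, ha⟩ := Finset.mem_erase.1 ha
      obtain ⟨rb, hb⟩ := Finset.mem_erase.1 hb
      obtain ⟨rc, hc⟩ := Finset.mem_erase.1 hc
      obtain ⟨rd, hd⟩ := Finset.mem_erase.1 hd
      have pa := hpos r a ra.symm
      have pb := hpos r b rb.symm
      have pc := hpos r c rc.symm
      have pd := hpos r d rd.symm
      have hMδ : ∀ x y, 0 < M r x → 0 < M r y → M x y = δ x y * (M r x * M r y) := by
        intro x y hx hy
        simp only [hδ]
        field_simp
      have hβ : 0 < δ a b := div_pos (hpos a b hab) (by positivity)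
      have hα : 0 < δ a c := div_pos (hpos a c hac) (by positivity)
      have h := h4 ha hb hc hd hab hac had hbc hbd hcd
      unfold FourPoint at h
      rw [hMδ a b pa pb, hMδ c d pc pd, hMδ a c pa pc, hMδ b d pb pd, hMδ a d pa pd,
        hMδ b c pb pc, ← e2, ← e1, ← e4, ← e3] at h
      have hP : M r a * M r b * M r c * M r d ≠ 0 := by positivity
      -- Up to the factor in `hP`, the three products are `β²`, `α²` and `α * β`. By positivity any
      -- coincidence gives `α = β`.
      rcases h with h | h | h
      · have : (δ a b) ^ 2 = (δ a c) ^ 2 := mul_right_cancel₀ hP (by linear_combination h)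
        exact (sq_eq_sq₀ hβ.le hα.le).1 this
      · have : δ a c * δ a c = δ a c * δ a b := mul_right_cancel₀ hP (by linear_combination h)
        exact (mul_left_cancel₀ hα.ne' this).symm
      · have : δ a b * δ a b = δ a b * δ a c := mul_right_cancel₀ hP (by linear_combination h)
        exact mul_left_cancel₀ hβ.ne' this
  obtain ⟨a, ha, b, hb, hab, htw⟩ := hU.exists_twins (by rw [Finset.card_erase_of_mem hr]; omega)
  obtain ⟨ra, ha⟩ := Finset.mem_erase.1 ha
  obtain ⟨rb, hb⟩ := Finset.mem_erase.1 hb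
  have pa := hpos r a ra.symm
  have pb := hpos r b rb.symm
  refine ⟨a, ha, b, hb, hab, M r b / M r a, div_pos pb pa, fun c hc hca hcb => ?_⟩
  by_cases hcr : c = r
  · rw [hcr, hM.symm b, hM.symm a]
    field_simp
  · have pc := hpos r c (Ne.symm hcr)
    have := htw c (Finset.mem_erase.2 ⟨hcr, hc⟩) hca hcb
    simp only [hδ] at this
    field_simp at this ⊢
    linarith

end Cherry

/-! ### Edge cuts and branches of trees -/

section TreeCuts

variable {N : Type*} {T : SimpleGraph N} {a b c : N} {S : Set N}

/-- The vertices on the side of `a` after deletion of the edge `ab`. -/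
def branch (T : SimpleGraph N) (a b : N) : Set N :=
  {x | (T.deleteEdges {s(a, b)}).Reachable a x}

/-- The edge `ab` is the only edge between `S` and its complement. -/
structure IsEdgeCut (T : SimpleGraph N) (a b : N) (S : Set N) : Prop where
  mem : a ∈ S
  notMem : b ∉ S
  eq_of_adj : ∀ x ∈ S, ∀ y ∉ S, T.Adj x y → x = a ∧ y = b

theorem IsEdgeCut.compl (h : IsEdgeCut T a b S) : IsEdgeCut T b a Sᶜ where
  mem := h.notMem
  notMem := fun h' => h' h.mem
  eq_of_adj x hx y hy hxy := (h.eq_of_adj y (not_not.1 hy) x hx hxy.symm).symm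

theorem IsEdgeCut.branch_subset (h : IsEdgeCut T a b S) : branch T a b ⊆ S := by
  intro x hx
  replace hx : (T.deleteEdges {s(a, b)}).Reachable a x := hx
  rw [SimpleGraph.reachable_iff_reflTransGen] at hx
  induction hx with
  | refl => exact h.mem
  | tail _ hyz ih =>
    rw [SimpleGraph.deleteEdges_adj] at hyz
    by_contra hz
    obtain ⟨rfl, rfl⟩ := h.eq_of_adj _ ih _ hz hyz.1
    exact hyz.2 rfl

/-- Along a walk from `a`, each vertex is reachable without the edge `ab` from `a` or from `b`,
according to its side of `S`. Sides can thus be computed by exhibiting a cut. -/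
theorem IsEdgeCut.branch_eq (hT : T.Preconnected) (h : IsEdgeCut T a b S) : branch T a b = S := by
  refine Set.Subset.antisymm h.branch_subset ?_
  suffices H : ∀ x, Relation.ReflTransGen T.Adj a x →
      (x ∈ S → (T.deleteEdges {s(a, b)}).Reachable a x) ∧
        (x ∉ S → (T.deleteEdges {s(a, b)}).Reachable b x) from fun x hx =>
    (H x ((SimpleGraph.reachable_iff_reflTransGen _ _).1 (hT a x))).1 hx
  intro x hx
  induction hx with
  | refl => exact ⟨fun _ => SimpleGraph.Reachable.refl _, fun h' => absurd h.mem h'⟩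
  | tail _ hyz ih =>
    rename_i y z _
    have hadj : (y ∈ S ↔ z ∈ S) → (T.deleteEdges {s(a, b)}).Adj y z := by
      intro hiff
      rw [SimpleGraph.deleteEdges_adj]
      refine ⟨hyz, fun e => ?_⟩
      rcases Sym2.eq_iff.1 (Set.mem_singleton_iff.1 e) with ⟨rfl, rfl⟩ | ⟨rfl, rfl⟩
      · exact h.notMem (hiff.1 h.mem)
      · exact h.notMem (hiff.2 h.mem)
    by_cases hy : y ∈ S <;> by_cases hz : z ∈ S
    · exact ⟨fun _ => (ih.1 hy).trans (hadj (iff_of_true hy hz)).reachable, fun h' => absurd hz h'⟩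
    · obtain ⟨rfl, rfl⟩ := h.eq_of_adj y hy z hz hyz
      exact ⟨fun h' => absurd h' hz, fun _ => SimpleGraph.Reachable.refl _⟩
    · obtain ⟨rfl, rfl⟩ := h.eq_of_adj z hz y hy hyz.symm
      exact ⟨fun _ => SimpleGraph.Reachable.refl _, fun h' => absurd hz h'⟩
    · exact ⟨fun h' => absurd h' hz, fun _ => (ih.2 hy).trans (hadj (iff_of_false hy hz)).reachable⟩

theorem isEdgeCut_branch (hT : T.IsTree) (hab : T.Adj a b) : IsEdgeCut T a b (branch T a b) where
  mem := SimpleGraph.Reachable.refl _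
  notMem := SimpleGraph.isBridge_iff.1 (SimpleGraph.isAcyclic_iff_forall_adj_isBridge.1 hT.isAcyclic hab)
  eq_of_adj x hx y hy hxy := by
    by_contra hcon
    have hbr : b ∉ branch T a b := SimpleGraph.isBridge_iff.1
      (SimpleGraph.isAcyclic_iff_forall_adj_isBridge.1 hT.isAcyclic hab)
    have hadj : (T.deleteEdges {s(a, b)}).Adj x y := by
      rw [SimpleGraph.deleteEdges_adj]
      refine ⟨hxy, fun e => ?_⟩
      rcases Sym2.eq_iff.1 (Set.mem_singleton_iff.1 e) with h | ⟨rfl, rfl⟩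
      · exact hcon h
      · exact hbr hx
    exact hy (SimpleGraph.Reachable.trans hx hadj.reachable)

theorem isTree_of_isEdgeCut (hT : T.Connected) (h : ∀ a b, T.Adj a b → ∃ S, IsEdgeCut T a b S) :
    T.IsTree := by
  refine ⟨hT, SimpleGraph.isAcyclic_iff_forall_adj_isBridge.2 fun a b hab => ?_⟩
  obtain ⟨S, hS⟩ := h a b hab
  exact SimpleGraph.isBridge_iff.2 fun h' => hS.notMem (hS.branch_subset h')

theorem branch_compl (hT : T.IsTree) (hab : T.Adj a b) : branch T b a = (branch T a b)ᶜ :=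
  (isEdgeCut_branch hT hab).compl.branch_eq hT.connected.preconnected

theorem exists_mem_branch (hT : T.IsTree) (hab : T.Adj a b) {x : N} (hx : x ∈ branch T a b)
    (hxa : x ≠ a) : ∃ c, T.Adj a c ∧ c ≠ b ∧ x ∈ branch T c a := by
  have H : ∀ y, Relation.ReflTransGen T.Adj a y → y = a ∨ ∃ c, T.Adj a c ∧ y ∈ branch T c a := by
    intro y hy
    induction hy with
    | refl => exact Or.inl rfl
    | tail _ hyz ih =>
      rename_i y z _
      rcases ih with rfl | ⟨c, hc, hyc⟩
      · exact Or.inr ⟨z, hyz, SimpleGraph.Reachable.refl _⟩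
      · by_cases hz : z ∈ branch T c a
        · exact Or.inr ⟨c, hc, hz⟩
        · exact Or.inl ((isEdgeCut_branch hT hc.symm).eq_of_adj y hyc z hz hyz).2
  rcases H x ((SimpleGraph.reachable_iff_reflTransGen _ _).1 (hT.connected.preconnected a x)) with
    h | ⟨c, hc, hxc⟩
  · exact absurd h hxa
  · refine ⟨c, hc, ?_, hxc⟩
    rintro rfl
    rw [branch_compl hT hab] at hxc
    exact hxc hx

theorem branch_ssubset (hT : T.IsTree) (hab : T.Adj a b) (hac : T.Adj a c) (hcb : c ≠ b) :
    branch T c a ⊂ branch T a b := by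
  have h1 := isEdgeCut_branch hT hab
  have h2 := isEdgeCut_branch hT hac.symm
  refine Set.ssubset_iff_of_subset ?_ |>.2 ⟨a, h1.mem, h2.notMem⟩
  intro x hx
  replace hx : (T.deleteEdges {s(c, a)}).Reachable c x := hx
  rw [SimpleGraph.reachable_iff_reflTransGen] at hx
  induction hx with
  | refl =>
    by_contra hc
    exact hcb (h1.eq_of_adj a h1.mem c hc hac).2
  | tail hy hyz ih =>
    by_contra hz
    have := (h1.eq_of_adj _ ih _ hz ((SimpleGraph.deleteEdges_adj.1 hyz).1)).1
    rw [this] at hy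
    exact h2.notMem ((SimpleGraph.reachable_iff_reflTransGen _ _).2 hy)

end TreeCuts

/-! ### Attaching two leaves to a tree -/

section AttachLeaves

variable {N : Type*}

/-- The graph obtained from `T` by attaching two new leaves at the vertex `t`. -/
def attachLeaves (T : SimpleGraph N) (t : N) : SimpleGraph (N ⊕ Bool) where
  Adj
    | .inl x, .inl y => T.Adj x y
    | .inl x, .inr _ => x = t
    | .inr _, .inl x => x = t
    | .inr _, .inr _ => False
  symm := ⟨by rintro (x | i) (y | j) h <;> first | exact T.adj_symm h | exact h⟩
  loopless := ⟨by rintro (x | i) h <;> first | exact T.irrefl h | exact h⟩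

variable {T : SimpleGraph N} {t : N}

theorem attachLeaves_connected (hT : T.Connected) : (attachLeaves T t).Connected := by
  have h1 : ∀ x, (attachLeaves T t).Reachable (.inl t) x := by
    rintro (x | i)
    · have := hT.preconnected t x
      exact this.map (⟨Sum.inl, fun h => h⟩ : T →g attachLeaves T t)
    · exact SimpleGraph.Adj.reachable (show (attachLeaves T t).Adj (.inl t) (.inr i) from rfl)
  exact (SimpleGraph.connected_iff _).2 ⟨fun x y => (h1 x).symm.trans (h1 y), ⟨.inl t⟩⟩

/-- The extension of a set of vertices by the new leaves if it contains their neighbour. -/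
def extendSet (t : N) (S : Set N) : Set (N ⊕ Bool) :=
  {x | Sum.elim id (fun _ => t) x ∈ S}

theorem IsEdgeCut.extendSet {a b : N} {S : Set N} (h : IsEdgeCut T a b S) :
    IsEdgeCut (attachLeaves T t) (.inl a) (.inl b) (extendSet t S) where
  mem := h.mem
  notMem := h.notMem
  eq_of_adj := by
    rintro (x | i) hx (y | j) hy hxy
    · obtain ⟨rfl, rfl⟩ := h.eq_of_adj x hx y hy hxy
      exact ⟨rfl, rfl⟩
    · obtain rfl : x = t := hxy
      exact absurd hx hy
    · obtain rfl : y = t := hxy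
      exact absurd hx hy
    · exact hxy.elim

theorem isEdgeCut_attachLeaves_inr (i : Bool) :
    IsEdgeCut (attachLeaves T t) (.inr i) (.inl t) {.inr i} where
  mem := rfl
  notMem := by simp
  eq_of_adj := by
    rintro x rfl (y | j) _ hxy
    · obtain rfl : y = t := hxy
      exact ⟨rfl, rfl⟩
    · exact hxy.elim

theorem attachLeaves_isTree (hT : T.IsTree) : (attachLeaves T t).IsTree := by
  refine isTree_of_isEdgeCut (attachLeaves_connected hT.connected) ?_
  rintro (a | i) (b | j) hab
  · exact ⟨_, (isEdgeCut_branch hT hab).extendSet⟩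
  · obtain rfl : a = t := hab
    exact ⟨_, (isEdgeCut_attachLeaves_inr j).compl⟩
  · obtain rfl : b = t := hab
    exact ⟨_, isEdgeCut_attachLeaves_inr i⟩
  · exact hab.elim

theorem attachLeaves_degree_inl [Fintype N] (x : N) :
    (attachLeaves T t).degree (.inl x) = T.degree x + if x = t then 2 else 0 := by
  rw [← SimpleGraph.card_neighborFinset_eq_degree, ← SimpleGraph.card_neighborFinset_eq_degree]
  have : (attachLeaves T t).neighborFinset (.inl x)
      = (T.neighborFinset x).disjSum (if x = t then Finset.univ else ∅) := by
    ext y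
    rw [SimpleGraph.mem_neighborFinset]
    rcases y with y | j
    · rw [Finset.inl_mem_disjSum, SimpleGraph.mem_neighborFinset]
      rfl
    · rw [Finset.inr_mem_disjSum]
      change x = t ↔ _
      split_ifs with h <;> simp [h]
  rw [this, Finset.card_disjSum]
  split_ifs <;> simp

theorem attachLeaves_degree_inr [Fintype N] (i : Bool) :
    (attachLeaves T t).degree (.inr i) = 1 := by
  rw [← SimpleGraph.card_neighborFinset_eq_degree, Finset.card_eq_one]
  refine ⟨.inl t, ?_⟩
  ext y
  rw [SimpleGraph.mem_neighborFinset, Finset.mem_singleton]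
  rcases y with y | j
  · rw [Sum.inl.injEq]
    rfl
  · simp only [reduceCtorEq, iff_false]
    exact fun h => h

end AttachLeaves

/-! ### Building a decomposition by adding twins -/

section Decomposition

/-- The decomposition obtained from a decomposition of `V \ {b}` by replacing the leaf `a` with
an inner vertex that has the leaves `a` and `b` as neighbours. -/
def RankDecomposition.addTwin {V : Type u} {a b : V} (hab : a ≠ b)
    (D : RankDecomposition {v : V // v ≠ b}) : RankDecomposition V where
  Node := D.Node ⊕ Bool
  tree := attachLeaves D.tree (D.leaf ⟨a, hab⟩)
  isTree := attachLeaves_isTree D.isTree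
  leaf v := if hb : v = b then .inr true else if v = a then .inr false else .inl (D.leaf ⟨v, hb⟩)
  leaf_injective := by
    intro v v' h
    by_cases h1 : v = b <;> by_cases h2 : v' = b <;> by_cases h3 : v = a <;>
      by_cases h4 : v' = a <;> simp_all
    have := D.leaf_injective h
    simpa using this
  degree_eq_one_iff := by
    have hrange : ∀ x : D.Node, (Sum.inl x : D.Node ⊕ Bool) ∈ Set.range (fun v => if hb : v = b then
        (.inr true : D.Node ⊕ Bool) else if v = a then .inr false else .inl (D.leaf ⟨v, hb⟩)) ↔
        x ∈ Set.range D.leaf ∧ x ≠ D.leaf ⟨a, hab⟩ := by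
      intro x
      constructor
      · rintro ⟨v, hv⟩
        dsimp only at hv
        split_ifs at hv with h1 h2
        obtain rfl := Sum.inl.inj hv
        refine ⟨⟨_, rfl⟩, fun e => h2 ?_⟩
        exact congrArg Subtype.val (D.leaf_injective e)
      · rintro ⟨⟨⟨v, hv⟩, rfl⟩, hne⟩
        refine ⟨v, ?_⟩
        dsimp only
        rw [dif_neg hv, if_neg]
        rintro rfl
        exact hne rfl
    rintro (x | i)
    · rw [hrange, attachLeaves_degree_inl, ← D.degree_eq_one_iff]
      split_ifs with h
      · have := (D.degree_eq_one_iff x).2 ⟨_, h.symm⟩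
        simp [h]
      · simp [h]
    · refine iff_of_true (attachLeaves_degree_inr i) ?_
      cases i
      · exact ⟨a, by simp [hab]⟩
      · exact ⟨b, by simp⟩
  degree_eq_three := by
    rintro (x | i) hx
    · rw [attachLeaves_degree_inl]
      split_ifs with h
      · rw [(D.degree_eq_one_iff x).2 ⟨_, h.symm⟩]
      · rw [D.degree_eq_three]
        rintro ⟨⟨v, hv⟩, rfl⟩
        refine hx ⟨v, ?_⟩
        dsimp only
        rw [dif_neg hv, if_neg]
        rintro rfl
        exact h rfl
    · exfalso
      apply hx
      cases i
      · exact ⟨a, by simp [hab]⟩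
      · exact ⟨b, by simp⟩

theorem RankDecomposition.side_eq_of_isEdgeCut {V : Type u} (D : RankDecomposition V) {s t : D.Node}
    {S : Set D.Node} (h : IsEdgeCut D.tree s t S) : D.side s t = D.leaf ⁻¹' S := by
  have := h.branch_eq D.isTree.connected.preconnected
  rw [← this]
  rfl

theorem CutMinorsVanish.of_subsingleton {V : Type*} (M : V → V → ℝ) {A : Set V}
    (h : A.Subsingleton) : CutMinorsVanish M A := by
  intro a ha a' ha' b _ b' _
  rw [h ha ha', mul_comm]

theorem CutMinorsVanish.of_twin {V : Type*} {M : V → V → ℝ} (hM : IsWeight M) {a b : V}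
    {hab : a ≠ b} {l : ℝ} (htw : ∀ c, c ≠ a → c ≠ b → M b c = l * M a c)
    {A : Set {v : V // v ≠ b}} (hA : CutMinorsVanish (fun u v : {v : V // v ≠ b} => M u v) A) :
    CutMinorsVanish M {v | (if hv : v = b then ⟨a, hab⟩ else ⟨v, hv⟩ : {v : V // v ≠ b}) ∈ A} := by
  set π : V → {v : V // v ≠ b} := fun v => if hv : v = b then ⟨a, hab⟩ else ⟨v, hv⟩ with hπ
  -- Entries across the cut are those of the merged vertices rescaled by `k u * k v`, so all terms
  -- of a minor acquire the same factor.
  set k : V → ℝ := fun v => if v = b then l else 1 with hk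
  have key : ∀ u v, π u ∈ A → π v ∉ A → M u v = k u * k v * M (π u) (π v) := by
    intro u v hu hv
    have hne : π u ≠ π v := fun e => hv (e ▸ hu)
    by_cases h1 : u = b <;> by_cases h2 : v = b
    · simp [hπ, h1, h2] at hne
    · have : v ≠ a := by
        rintro rfl
        simp [hπ, h1, h2] at hne
      simp [hπ, hk, h1, h2, htw v this h2]
    · have : u ≠ a := by
        rintro rfl
        simp [hπ, h1, h2] at hne
      simp only [hπ, hk, h1, h2, if_true, if_false, dif_pos, dif_neg, not_false_eq_true]
      rw [hM.symm u b, htw u this h1, hM.symm a u]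
      ring
    · simp [hπ, hk, h1, h2]
  intro c hc c' hc' d hd d' hd'
  rw [key c d hc hd, key c' d' hc' hd', key c d' hc hd', key c' d hc' hd]
  have := hA _ hc _ hc' _ hd _ hd'
  dsimp only at this
  linear_combination (k c * k d * k c' * k d') * this

/-- The decomposition of a set with two elements. -/
def RankDecomposition.ofCardTwo (V : Type u) [Fintype V] (h : Fintype.card V = 2) :
    RankDecomposition V where
  Node := V
  tree := ⊤
  isTree :=
    haveI : Nonempty V := Fintype.card_pos_iff.1 (by omega)
    ⟨SimpleGraph.connected_top, SimpleGraph.IsAcyclic.of_card_le_two (by simp [h])⟩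
  leaf := id
  leaf_injective := Function.injective_id
  degree_eq_one_iff t := by
    have : (⊤ : SimpleGraph V).degree t = 1 := by
      rw [← SimpleGraph.card_neighborFinset_eq_degree]
      have : (⊤ : SimpleGraph V).neighborFinset t = Finset.univ.erase t := by
        ext u
        simp [eq_comm]
      rw [this, Finset.card_erase_of_mem (Finset.mem_univ t), Finset.card_univ, h]
    refine iff_of_true ?_ ⟨t, rfl⟩
    convert this
  degree_eq_three t ht := by simp at ht

/-- Remove one vertex of a cherry, decompose the rest and reattach it beside its twin. The new cuts
are old ones with the twins kept together, or cuts at a single leaf. -/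
theorem exists_rankDecomposition (n : ℕ) : ∀ (V : Type u) [Fintype V] (M : V → V → ℝ),
    Fintype.card V = n + 2 → IsWeight M → (∀ a b, a ≠ b → 0 < M a b) →
    (∀ {a b c d : V}, a ≠ b → a ≠ c → a ≠ d → b ≠ c → b ≠ d → c ≠ d → FourPoint M a b c d) →
    ∃ D : RankDecomposition V, ∀ s t, D.tree.Adj s t → CutMinorsVanish M (D.side s t) := by
  induction n with
  | zero =>
    intro V _ M hcard _ _ _
    refine ⟨RankDecomposition.ofCardTwo V hcard, fun s t _ => ?_⟩
    intro a ha a' ha' b hb b' hb'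
    by_cases hne : a = a'
    · rw [hne, mul_comm]
    · have h1 : a ≠ b := fun e => hb (e ▸ ha)
      have h2 : a' ≠ b := fun e => hb (e ▸ ha')
      have : ({a, a', b} : Finset V).card ≤ 2 := (Finset.card_le_univ _).trans_eq hcard
      rw [Finset.card_eq_three.2 ⟨a, a', b, hne, h1, h2, rfl⟩] at this
      omega
  | succ n ih =>
    intro V _ M hcard hM hpos h4
    obtain ⟨a, -, b, -, hab, l, -, htw⟩ := exists_cherry_of_fourPoint hM hpos (W := Finset.univ)
      (by rw [Finset.card_univ]; omega) (fun _ _ _ _ => h4)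
    obtain ⟨D, hD⟩ := ih {v : V // v ≠ b} (fun u v => M u v)
      (by rw [Fintype.card_subtype_compl]; simp [hcard])
      ⟨fun u v => hM.symm u v, fun u => hM.diag u, fun u v => hM.nonneg u v⟩
      (fun u v huv => hpos u v (Subtype.coe_injective.ne huv))
      (fun h1 h2 h3 h4' h5 h6 => h4 (Subtype.coe_injective.ne h1) (Subtype.coe_injective.ne h2)
        (Subtype.coe_injective.ne h3) (Subtype.coe_injective.ne h4') (Subtype.coe_injective.ne h5)
        (Subtype.coe_injective.ne h6))
    refine ⟨D.addTwin hab, ?_⟩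
    have hsingle : ∀ i : Bool, CutMinorsVanish M ((D.addTwin hab).leaf ⁻¹' {.inr i}) := fun i =>
      CutMinorsVanish.of_subsingleton M fun x hx y hy =>
        (D.addTwin hab).leaf_injective (Eq.trans hx (Eq.symm hy))
    rintro (s | i) (t | j) hst
    · have hst' : D.tree.Adj s t := hst
      have hcut : IsEdgeCut (D.addTwin hab).tree (.inl s) (.inl t)
          (extendSet (D.leaf ⟨a, hab⟩) (branch D.tree s t)) :=
        (isEdgeCut_branch D.isTree hst').extendSet
      rw [(D.addTwin hab).side_eq_of_isEdgeCut hcut]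
      convert CutMinorsVanish.of_twin hM (hab := hab) (fun c => htw c (Finset.mem_univ c))
        (hD s t hst') using 1
      ext v
      change Sum.elim id (fun _ => D.leaf ⟨a, hab⟩) (if hb : v = b then .inr true else
        if v = a then .inr false else .inl (D.leaf ⟨v, hb⟩)) ∈ branch D.tree s t ↔
        D.leaf (if hv : v = b then ⟨a, hab⟩ else ⟨v, hv⟩) ∈ branch D.tree s t
      by_cases h1 : v = b
      · simp [h1]
      · by_cases h2 : v = a
        · simp [h2, hab]
        · simp [h1, h2]
    · obtain rfl : s = D.leaf ⟨a, hab⟩ := hst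
      have hcut : IsEdgeCut (D.addTwin hab).tree (.inl (D.leaf ⟨a, hab⟩)) (.inr j) {.inr j}ᶜ :=
        (isEdgeCut_attachLeaves_inr j).compl
      rw [(D.addTwin hab).side_eq_of_isEdgeCut hcut, Set.preimage_compl]
      exact (hsingle j).compl hM
    · obtain rfl : t = D.leaf ⟨a, hab⟩ := hst
      have hcut : IsEdgeCut (D.addTwin hab).tree (.inr i) (.inl (D.leaf ⟨a, hab⟩)) {.inr i} :=
        isEdgeCut_attachLeaves_inr i
      rw [(D.addTwin hab).side_eq_of_isEdgeCut hcut]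
      exact hsingle i
    · exact hst.elim

end Decomposition

/-! ### Finding a cherry in a given decomposition -/

section Decomposition

variable {V : Type u}

theorem RankDecomposition.branch_leaf (D : RankDecomposition V) {t s : D.Node} (h : D.tree.degree t = 1)
    (hts : D.tree.Adj t s) : branch D.tree t s = {t} := by
  refine Set.Subset.antisymm (fun x hx => ?_) ?_
  · by_contra hne
    obtain ⟨c, hc, hcs, -⟩ := exists_mem_branch D.isTree hts hx hne
    rw [← SimpleGraph.card_neighborFinset_eq_degree, Finset.card_eq_one] at h
    obtain ⟨y, hy⟩ := h
    have h1 : c ∈ ({y} : Finset _) := hy ▸ (SimpleGraph.mem_neighborFinset _ _ _).2 hc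
    have h2 : s ∈ ({y} : Finset _) := hy ▸ (SimpleGraph.mem_neighborFinset _ _ _).2 hts
    rw [Finset.mem_singleton] at h1 h2
    exact hcs (h1.trans h2.symm)
  · rintro x rfl
    exact (isEdgeCut_branch D.isTree hts).mem

theorem RankDecomposition.exists_adj_leaf (D : RankDecomposition V) (v : V) :
    ∃ s, D.tree.Adj (D.leaf v) s := by
  have h := (D.degree_eq_one_iff (D.leaf v)).2 ⟨v, rfl⟩
  exact (SimpleGraph.degree_pos_iff_exists_adj _ _).1 (by omega)

/-- Take a smallest branch containing at least two elements of `W`. Its root `s` is not a leaf, so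
it has two further branches, each with at most one element of `W` by minimality. -/
theorem RankDecomposition.exists_side_card_eq_two (D : RankDecomposition V) {W : Finset V}
    (hW : 3 ≤ W.card) :
    ∃ s t, D.tree.Adj s t ∧ (W.filter fun v => v ∈ D.side s t).card = 2 := by
  set P : ℕ → Prop := fun n => ∃ s t, D.tree.Adj s t ∧ (branch D.tree s t).ncard = n ∧
    2 ≤ (W.filter fun v => v ∈ D.side s t).card with hP
  have hex : ∃ n, P n := by
    obtain ⟨v, hv⟩ : W.Nonempty := Finset.card_pos.1 (by omega)
    obtain ⟨s, hs⟩ := D.exists_adj_leaf v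
    refine ⟨_, s, D.leaf v, hs.symm, rfl, ?_⟩
    have : W.erase v ⊆ W.filter fun u => u ∈ D.side s (D.leaf v) := by
      intro u hu
      obtain ⟨huv, huW⟩ := Finset.mem_erase.1 hu
      refine Finset.mem_filter.2 ⟨huW, ?_⟩
      change D.leaf u ∈ branch D.tree s (D.leaf v)
      rw [branch_compl D.isTree hs, D.branch_leaf ((D.degree_eq_one_iff _).2 ⟨v, rfl⟩) hs]
      exact fun e => huv (D.leaf_injective e)
    have h1 := Finset.card_le_card this
    rw [Finset.card_erase_of_mem hv] at h1
    omega
  obtain ⟨s, t, hst, hn, h2⟩ := Nat.find_spec hex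
  refine ⟨s, t, hst, le_antisymm ?_ h2⟩
  have hmin : ∀ c, D.tree.Adj s c → c ≠ t → (W.filter fun v => v ∈ D.side c s).card ≤ 1 := by
    intro c hc hct
    by_contra hcon
    refine Nat.find_min hex (m := (branch D.tree c s).ncard) ?_ ⟨c, s, hc.symm, rfl, by omega⟩
    rw [← hn]
    exact Set.ncard_lt_ncard (branch_ssubset D.isTree hst hc hct) (Set.toFinite _)
  have hs : s ∉ Set.range D.leaf := by
    rintro ⟨v, rfl⟩
    have : (W.filter fun u => u ∈ D.side (D.leaf v) t) ⊆ {v} := by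
      intro u hu
      have hu : D.leaf u ∈ branch D.tree (D.leaf v) t := (Finset.mem_filter.1 hu).2
      rw [D.branch_leaf ((D.degree_eq_one_iff _).2 ⟨v, rfl⟩) hst] at hu
      exact Finset.mem_singleton.2 (D.leaf_injective hu)
    have := Finset.card_le_card this
    rw [Finset.card_singleton] at this
    omega
  have hdeg := D.degree_eq_three s hs
  rw [← SimpleGraph.card_neighborFinset_eq_degree] at hdeg
  have hcard : ((D.tree.neighborFinset s).erase t).card = 2 := by
    rw [Finset.card_erase_of_mem ((SimpleGraph.mem_neighborFinset _ _ _).2 hst), hdeg]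
  obtain ⟨c, e, -, hce⟩ := Finset.card_eq_two.1 hcard
  have hmem : ∀ x, x ∈ ({c, e} : Finset D.Node) ↔ x ≠ t ∧ D.tree.Adj s x := fun x => by
    rw [← hce, Finset.mem_erase, SimpleGraph.mem_neighborFinset]
  have hc := (hmem c).1 (by simp)
  have he := (hmem e).1 (by simp)
  have hsub : (W.filter fun v => v ∈ D.side s t) ⊆
      (W.filter fun v => v ∈ D.side c s) ∪ (W.filter fun v => v ∈ D.side e s) := by
    intro v hv
    obtain ⟨hvW, hv⟩ := Finset.mem_filter.1 hv
    obtain ⟨x, hx, hxt, hvx⟩ := exists_mem_branch D.isTree hst hv fun e => hs ⟨v, e⟩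
    have := (hmem x).2 ⟨hxt, hx⟩
    rw [Finset.mem_insert, Finset.mem_singleton] at this
    rw [Finset.mem_union, Finset.mem_filter, Finset.mem_filter]
    rcases this with rfl | rfl
    · exact Or.inl ⟨hvW, hvx⟩
    · exact Or.inr ⟨hvW, hvx⟩
  have h3 := (Finset.card_le_card hsub).trans (Finset.card_union_le _ _)
  have h4 := hmin c hc.2 hc.1
  have h5 := hmin e he.2 he.1
  omega

theorem RankDecomposition.exists_cherry (D : RankDecomposition V) {M : V → V → ℝ}
    (hD : ∀ s t, D.tree.Adj s t → CutMinorsVanish M (D.side s t)) {W : Finset V}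
    (hW : 3 ≤ W.card) : ∃ a ∈ W, ∃ b ∈ W, a ≠ b ∧ ∀ c ∈ W, c ≠ a → c ≠ b → ∀ d ∈ W, d ≠ a → d ≠ b →
      M a c * M b d = M a d * M b c := by
  obtain ⟨s, t, hst, h2⟩ := D.exists_side_card_eq_two hW
  obtain ⟨a, b, hab, heq⟩ := Finset.card_eq_two.1 h2
  have hmem : ∀ x, x ∈ W ∧ x ∈ D.side s t ↔ x = a ∨ x = b := fun x => by
    rw [← Finset.mem_filter (p := fun v => v ∈ D.side s t), heq, Finset.mem_insert,
      Finset.mem_singleton]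
  have ha := (hmem a).2 (Or.inl rfl)
  have hb := (hmem b).2 (Or.inr rfl)
  have hnot : ∀ c ∈ W, c ≠ a → c ≠ b → c ∉ D.side s t := fun c hc hca hcb h =>
    ((hmem c).1 ⟨hc, h⟩).elim hca hcb
  exact ⟨a, ha.1, b, hb.1, hab, fun c hc hca hcb d hd hda hdb =>
    hD s t hst a ha.2 b hb.2 c (hnot c hc hca hcb) d (hnot d hd hda hdb)⟩

end Decomposition

/-! ### Rigidity by successive merging of twins -/

section Stability

variable {V : Type*}

theorem exists_proportional {M : V → V → ℝ} (hM : IsWeight M) {W : Finset V} {a b : V}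
    (ha : a ∈ W) (hb : b ∈ W) (hab : a ≠ b)
    (h : ∀ c ∈ W, c ≠ a → c ≠ b → ∀ d ∈ W, d ≠ a → d ≠ b → M a c * M b d = M a d * M b c) :
    ∃ a ∈ W, ∃ b ∈ W, a ≠ b ∧ ∃ l, 0 ≤ l ∧ ∀ c ∈ W, c ≠ a → c ≠ b → M b c = l * M a c := by
  by_cases h0 : ∀ c ∈ W, c ≠ a → c ≠ b → M a c = 0
  -- If the row of `a` vanishes outside the pair, the roles are exchanged and the factor is zero.
  · exact ⟨b, hb, a, ha, hab.symm, 0, le_rfl, fun c hc hcb hca => by rw [h0 c hc hca hcb, zero_mul]⟩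
  · push Not at h0
    obtain ⟨d, hd, hda, hdb, hne⟩ := h0
    refine ⟨a, ha, b, hb, hab, M b d / M a d, div_nonneg (hM.nonneg b d) (hM.nonneg a d),
      fun c hc hca hcb => ?_⟩
    have := h c hc hca hcb d hd hda hdb
    field_simp
    linarith

/-- Put `b` on the same side as `a`. A crossing edge at `b` then ends outside the pair and can be
replaced by one at `a`. -/
theorem ConnectedOn.erase_twin {M : V → V → ℝ} (hM : IsWeight M) {W : Finset V} {a b : V}
    (ha : a ∈ W) (hab : a ≠ b) {l : ℝ}
    (htw : ∀ c ∈ W, c ≠ a → c ≠ b → M b c = l * M a c) (h : ConnectedOn M W) :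
    ConnectedOn M (W.erase b) := by
  have haW : a ∈ W.erase b := Finset.mem_erase.2 ⟨hab, ha⟩
  have htw' : ∀ c ∈ W, c ≠ a → c ≠ b → M b c ≠ 0 → M a c ≠ 0 := fun c hc hca hcb hbc e =>
    hbc (by rw [htw c hc hca hcb, e, mul_zero])
  intro A ⟨x, hx, hxA⟩ ⟨y, hy, hyA⟩
  obtain ⟨hxb, hxW⟩ := Finset.mem_erase.1 hx
  obtain ⟨hyb, hyW⟩ := Finset.mem_erase.1 hy
  by_cases haA : a ∈ A
  · obtain ⟨u, hu, v, hv, huA, hvA, huv⟩ := h (insert b A) ⟨x, hxW, Set.mem_insert_of_mem _ hxA⟩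
      ⟨y, hyW, by simp [hyb, hyA]⟩
    simp only [Set.mem_insert_iff, not_or] at huA hvA
    have hva : v ≠ a := fun e => hvA.2 (e ▸ haA)
    have hvW := Finset.mem_erase.2 ⟨hvA.1, hv⟩
    by_cases hub : u = b
    · rw [hub] at huv
      exact ⟨a, haW, v, hvW, haA, hvA.2, htw' v hv hva hvA.1 huv⟩
    · exact ⟨u, Finset.mem_erase.2 ⟨hub, hu⟩, v, hvW, huA.resolve_left hub, hvA.2, huv⟩
  · obtain ⟨u, hu, v, hv, huA, hvA, huv⟩ := h (A \ {b}) ⟨x, hxW, hxA, hxb⟩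
      ⟨y, hyW, fun e => hyA e.1⟩
    have hub : u ≠ b := huA.2
    have hua : u ≠ a := fun e => haA (e ▸ huA.1)
    have huW := Finset.mem_erase.2 ⟨hub, hu⟩
    by_cases hvb : v = b
    · rw [hvb, hM.symm] at huv
      exact ⟨u, huW, a, haW, huA.1, haA, by rw [hM.symm]; exact htw' u hu hua hub huv⟩
    · exact ⟨u, huW, v, Finset.mem_erase.2 ⟨hvb, hv⟩, huA.1, fun e => hvA ⟨e, hvb⟩, huv⟩

theorem rigidOn_of_exists_cherry {M : V → V → ℝ} (hM : IsWeight M)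
    (hch : ∀ W : Finset V, 3 ≤ W.card → ∃ a ∈ W, ∃ b ∈ W, a ≠ b ∧ ∀ c ∈ W, c ≠ a → c ≠ b →
      ∀ d ∈ W, d ≠ a → d ≠ b → M a c * M b d = M a d * M b c) (W : Finset V) :
    ConnectedOn M W → RigidOn M W := by
  induction W using Finset.strongInduction with
  | H W ih =>
    intro hconn
    by_cases h3 : 3 ≤ W.card
    · obtain ⟨a₀, ha₀, b₀, hb₀, hab₀, h⟩ := hch W h3
      obtain ⟨a, ha, b, hb, hab, l, hl, htw⟩ := exists_proportional hM ha₀ hb₀ hab₀ h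
      refine RigidOn.of_twin hM ha hb hab hl htw ?_
        (ih _ (Finset.erase_ssubset hb) (hconn.erase_twin hM ha hab htw))
      -- An edge at `b` supplies the nondegeneracy needed for merging: it leads to `a`, or to a
      -- vertex also joined to `a`.
      obtain ⟨u, hu, v, hv, hub, hvb, huv⟩ := hconn {b} ⟨b, hb, rfl⟩ ⟨a, ha, hab⟩
      rw [Set.mem_singleton_iff] at hub hvb
      rw [hub] at huv
      by_cases hva : v = a
      · left
        rwa [hM.symm, ← hva]
      · right
        rw [htw v hv hva hvb] at huv
        exact ⟨left_ne_zero_of_mul huv, v, hv, hva, hvb, right_ne_zero_of_mul huv⟩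
    · intro x hx z hz a ha b hb
      by_contra hne
      have hab : a ≠ b := fun e => hne (by rw [e])
      have hW : W = {a, b} := by
        refine (Finset.eq_of_subset_of_card_le ?_ ?_).symm
        · intro c hc
          simp only [Finset.mem_insert, Finset.mem_singleton] at hc
          rcases hc with rfl | rfl <;> assumption
        · rw [Finset.card_pair hab]
          omega
      obtain ⟨u, hu, v, hv, hua, hva, huv⟩ := hconn {a} ⟨a, ha, rfl⟩ ⟨b, hb, hab.symm⟩
      rw [Set.mem_singleton_iff] at hua hva
      rw [hW, Finset.mem_insert, Finset.mem_singleton] at hv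
      rw [hua, hv.resolve_left hva] at huv
      have := hz a ha
      rw [hW, Finset.sum_pair hab, hM.diag] at this
      simp only [Complex.ofReal_zero, zero_mul, zero_add, mul_eq_zero, Complex.ofReal_eq_zero,
        sub_eq_zero] at this
      rcases this with (h | h) | h
      · exact huv h
      · have := hx b
        simp [h] at this
      · exact hne h.symm

end Stability

/-! ### Cut-rank in terms of minors -/

section CutRank

variable {V : Type*} {G : SimpleGraph V} {w : Sym2 V → ℝ}

theorem isWeight_adjMatrix (hw : ∀ e ∈ G.edgeSet, 0 < w e) : IsWeight (adjMatrix G w) where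
  symm a b := by simp [adjMatrix, SimpleGraph.adj_comm, Sym2.eq_swap]
  diag a := by simp [adjMatrix]
  nonneg a b := by
    simp only [adjMatrix, Matrix.of_apply]
    split_ifs with h
    · exact (hw _ h).le
    · exact le_rfl

theorem connectedOn_adjMatrix [Fintype V] (hw : ∀ e ∈ G.edgeSet, 0 < w e) (hG : G.Connected) :
    ConnectedOn (adjMatrix G w) Finset.univ := by
  rintro A ⟨a, -, ha⟩ ⟨b, -, hb⟩
  by_contra! hcon
  refine hb ?_
  have := (SimpleGraph.reachable_iff_reflTransGen _ _).1 (hG.preconnected a b)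
  clear hb
  induction this with
  | refl => exact ha
  | tail _ hyz ih =>
    by_contra hz
    have := hcon _ (Finset.mem_univ _) _ (Finset.mem_univ _) ih hz
    rw [adjMatrix, Matrix.of_apply, if_pos hyz] at this
    exact (hw _ hyz).ne' this

theorem cutRank_le_one_iff [Fintype V] (hw : ∀ e ∈ G.edgeSet, 0 < w e) (A : Set V) :
    cutRank G w A ≤ 1 ↔ CutMinorsVanish (adjMatrix G w) A := by
  have hM := isWeight_adjMatrix hw
  unfold cutRank rk
  constructor
  · intro h a ha a' ha' b hb b' hb'
    by_contra hne
    set f : Fin 2 → (Aᶜ : Set V) := ![⟨b, hb⟩, ⟨b', hb'⟩] with hf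
    set g : Fin 2 → A := ![⟨a, ha⟩, ⟨a', ha'⟩] with hg
    have hle := (Matrix.rank_submatrix_le ((adjMatrix G w).submatrix
      (Subtype.val : (Aᶜ : Set V) → V) (Subtype.val : A → V)) f g).trans h
    rw [Matrix.rank_of_det_ne_zero] at hle
    · simp at hle
    · rw [Matrix.det_fin_two]
      simp only [Matrix.submatrix_apply, hf, hg, Matrix.cons_val_zero, Matrix.cons_val_one]
      rw [hM.symm b a, hM.symm b' a', hM.symm b a', hM.symm b' a, mul_comm (adjMatrix G w a' b)]
      exact sub_ne_zero.2 hne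
  · intro h
    by_cases h0 : ∀ b : (Aᶜ : Set V), ∀ a : A, adjMatrix G w b a = 0
    · have : (adjMatrix G w).submatrix (Subtype.val : (Aᶜ : Set V) → V) (Subtype.val : A → V)
          = 0 := by
        ext b a
        exact h0 b a
      rw [this, Matrix.rank_zero]
      exact zero_le_one
    · push Not at h0
      obtain ⟨b₀, a₀, hne⟩ := h0
      -- With a nonzero pivot at `b₀, a₀`, vanishing minors express the matrix as an outer product.
      have : (adjMatrix G w).submatrix (Subtype.val : (Aᶜ : Set V) → V) (Subtype.val : A → V)
          = Matrix.vecMulVec (fun b : (Aᶜ : Set V) => adjMatrix G w b a₀)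
            (fun a : A => adjMatrix G w b₀ a / adjMatrix G w b₀ a₀) := by
        ext b a
        rw [Matrix.vecMulVec_apply, Matrix.submatrix_apply]
        field_simp
        have := h a a.2 a₀ a₀.2 b b.2 b₀ b₀.2
        rw [hM.symm a b, hM.symm a₀ b₀, hM.symm a b₀, hM.symm a₀ b] at this
        linarith
      rw [this]
      exact Matrix.rank_vecMulVec_le _ _

theorem cutRank_pos [Fintype V] (hw : ∀ e ∈ G.edgeSet, 0 < w e) (hG : G.Connected) {A : Set V}
    (hA : A.Nonempty) (hA' : Aᶜ.Nonempty) : 0 < cutRank G w A := by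
  obtain ⟨x, hx⟩ := hA
  obtain ⟨y, hy⟩ := hA'
  obtain ⟨a, -, b, -, ha, hb, hab⟩ := connectedOn_adjMatrix hw hG A ⟨x, Finset.mem_univ _, hx⟩
    ⟨y, Finset.mem_univ _, hy⟩
  have hle := Matrix.rank_submatrix_le ((adjMatrix G w).submatrix
    (Subtype.val : (Aᶜ : Set V) → V) (Subtype.val : A → V))
    (fun _ : Fin 1 => ⟨b, hb⟩) (fun _ : Fin 1 => ⟨a, ha⟩)
  rw [Matrix.rank_of_det_ne_zero] at hle
  · exact lt_of_lt_of_le (by simp) hle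
  · rw [Matrix.det_fin_one]
    simp only [Matrix.submatrix_apply]
    rwa [(isWeight_adjMatrix hw).symm b a]

end CutRank

/-! ### Rank-width one as existence of a decomposition -/

section Main

variable {V : Type u} [Fintype V] {G : SimpleGraph V} {w : Sym2 V → ℝ}

/-- The edge at a leaf isolates one vertex, and connectedness makes that cut nonzero. -/
theorem RankDecomposition.one_le_width (D : RankDecomposition V) [Nontrivial V]
    (hw : ∀ e ∈ G.edgeSet, 0 < w e) (hG : G.Connected) : 1 ≤ D.width G w := by
  obtain ⟨v, v', hvv'⟩ := exists_pair_ne V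
  obtain ⟨s, hs⟩ := D.exists_adj_leaf v
  have hbr := D.branch_leaf ((D.degree_eq_one_iff _).2 ⟨v, rfl⟩) hs
  have hpos : 0 < cutRank G w (D.side (D.leaf v) s) := by
    refine cutRank_pos hw hG ⟨v, ?_⟩ ⟨v', ?_⟩
    · exact (isEdgeCut_branch D.isTree hs).mem
    · intro h
      have h : D.leaf v' ∈ branch D.tree (D.leaf v) s := h
      rw [hbr] at h
      exact hvv' (D.leaf_injective h).symm
  have hle := Finset.le_sup (f := fun d : D.tree.Dart => cutRank G w (D.side d.fst d.snd))
    (Finset.mem_univ (⟨(D.leaf v, s), hs⟩ : D.tree.Dart))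
  dsimp only at hle
  unfold RankDecomposition.width
  omega

theorem RankDecomposition.width_le_one_iff (D : RankDecomposition V)
    (hw : ∀ e ∈ G.edgeSet, 0 < w e) : D.width G w ≤ 1 ↔
      ∀ s t, D.tree.Adj s t → CutMinorsVanish (adjMatrix G w) (D.side s t) := by
  unfold RankDecomposition.width
  rw [Finset.sup_le_iff]
  constructor
  · intro h s t hst
    exact (cutRank_le_one_iff hw _).1 (h ⟨(s, t), hst⟩ (Finset.mem_univ _))
  · intro h d _
    exact (cutRank_le_one_iff hw _).2 (h d.fst d.snd d.adj)

theorem rankWidth_eq_one_iff [Nontrivial V] (hw : ∀ e ∈ G.edgeSet, 0 < w e) (hG : G.Connected) :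
    rankWidth G w = 1 ↔ ∃ D : RankDecomposition V,
      ∀ s t, D.tree.Adj s t → CutMinorsVanish (adjMatrix G w) (D.side s t) := by
  unfold rankWidth
  constructor
  · intro h
    -- The infimum of the empty set is `0`, so the value `1` already provides a decomposition.
    have hne : (Set.range fun D : RankDecomposition V => D.width G w).Nonempty :=
      Nat.nonempty_of_pos_sInf (by rw [h]; exact one_pos)
    obtain ⟨D, hD⟩ := Nat.sInf_mem hne
    exact ⟨D, (D.width_le_one_iff hw).1 (le_of_eq (hD.trans h))⟩
  · rintro ⟨D, hD⟩
    refine le_antisymm ((Nat.sInf_le (Set.mem_range_self D)).trans ((D.width_le_one_iff hw).2 hD)) ?_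
    obtain ⟨D', hD'⟩ := Nat.sInf_mem (Set.range_nonempty_iff_nonempty.2 ⟨D⟩ :
      (Set.range fun D : RankDecomposition V => D.width G w).Nonempty)
    rw [← hD']
    exact D'.one_le_width hw hG

end Main

end WeightedGraph

end

theorem theorem3 {V : Type*} [Fintype V] (G : SimpleGraph V) (w : Sym2 V → ℝ)
    (hw : ∀ e ∈ G.edgeSet, 0 < w e) (hG : G.Connected) (hV : 3 ≤ Fintype.card V) :
    WeightedGraph.IsDistanceHereditary G w ↔ WeightedGraph.rankWidth G w = 1 := by
  have : Nontrivial V := Fintype.one_lt_card_iff_nontrivial.1 (by omega)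
  have hM := WeightedGraph.isWeight_adjMatrix hw
  have hconn := WeightedGraph.connectedOn_adjMatrix hw hG
  rw [WeightedGraph.rankWidth_eq_one_iff hw hG]
  refine (WeightedGraph.isStable_iff_rigidOn G w).trans ⟨fun h => ?_, ?_⟩
  -- The tree is built for a positive matrix `N`, and its vanishing minors are transferred back by
  -- `hcut`.
  · obtain ⟨N, hN, hpos, hrigid, hcut⟩ := WeightedGraph.exists_positive_of_rigidOn hM hconn h
    obtain ⟨D, hD⟩ := WeightedGraph.exists_rankDecomposition (Fintype.card V - 2) V N (by omega)
      hN hpos (WeightedGraph.fourPoint_of_rigidOn hN hpos hrigid (Finset.mem_univ _)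
        (Finset.mem_univ _) (Finset.mem_univ _) (Finset.mem_univ _))
    exact ⟨D, fun s t hst => hcut _ (hD s t hst)⟩
  · rintro ⟨D, hD⟩
    exact WeightedGraph.rigidOn_of_exists_cherry hM (fun W hW => D.exists_cherry hD hW) _ hconn
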